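/- Let $V_1,\dots,V_M$ be variables taking values in finite sets, each with at least two elements, and let $Y$ be a reward variable with values in $[0,1]$. Let $\mathcal G$ be a directed acyclic graph on the nodes $V_1,\dots,V_M,Y$, whose variables are listed so that $V_i\to V_j$ implies $i<j$, and in which $Y$ is a leaf (has no outgoing edges). Let $\mathbf Z,\mathbf A\subseteq\{V_1,\dots,V_M\}$ be disjoint sets such that no parent of an element of $\mathbf A$ lies in $\mathbf Z$. Let $\mathscr P_{\mathbf V}$ be the set of probability distributions $p$ of $(V_1,\dots,V_M,Y)$ under which every joint value of $(V_1,\dots,V_M)$ has positive probability. The Markovian parents of $V_i$ under $p$ are the minimum-cardinality set $\mathbf S\subseteq\{V_1,\dots,V_{i-1}\}$ such that $V_i$ is conditionally independent of $\{V_1,\dots,V_{i-1}\}\setminus\mathbf S$ given $\mathbf S$; those of $Y$ are defined likewise, with $\mathbf S\subseteq\{V_1,\dots,V_M\}$. A distribution $p\in\mathscr P_{\mathbf V}$ is Markov relative to $\mathcal G$ if the Markovian parents of each node are among its parents in $\mathcal G$. Let $\mathcal A$ consist of the interventions $\mathrm{do}(\mathbf A=\mathbf a)$, for all joint values $\mathbf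 a$ of all the variables in $\mathbf A$, together with the null (purely observational) intervention, and let $\mathcal A_0$ be $\mathcal A$ with the null intervention removed. For $a=\mathrm{do}(\mathbf A=\mathbf a)$, the interventional distribution $p_a$ is given by $$p_a(Y\in B,\ V_1=v_1,\dots,V_M=v_M)=\mathbf 1\{v_{\mathbf A}=\mathbf a\}\; p\big(Y\in B\mid \mathrm{pa}(Y)=v_{\mathrm{pa}(Y)}\big)\prod_{i:\,V_i\notin\mathbf A}p\big(V_i=v_i\mid \mathrm{pa}(V_i)=v_{\mathrm{pa}(V_i)}\big),$$ where $\mathrm{pa}$ denotes parents in $\mathcal G$. The pair $(\mathcal G,\mathcal A_0)$ is conditionally benign if for every $p\in\mathscr P_{\mathbf V}$ that is Markov relative to $\mathcal G$ there is a probability distribution $q$ of $(\mathbf Z,Y)$ such that for every $a\in\mathcal A_0$ the marginal of $\mathbf Z$ under $p_a$ is absolutely continuous with respect to that under $q$, and $p_a(Y\mid\mathbf Z)=q(Y\mid\mathbf Z)$ holds $q$-almost surely. Let $\mathcal G_{\bar{\mathbf A}}$ be $\mathcal G$ with all edges into elements of $\mathbf A$ removed. Say that $\mathbf Z$ $d$-separates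 $Y$ from $\mathbf A$ on a graph if every (undirected) path between an element of $\mathbf A$ and $Y$ contains either a chain or a fork whose middle node is in $\mathbf Z$, or a collider $\cdot\to B\leftarrow\cdot$ such that no descendant of $B$ (including $B$) is in $\mathbf Z$. Then $\mathbf Z$ $d$-separates $Y$ from $\mathbf A$ on $\mathcal G_{\bar{\mathbf A}}$ if and only if $(\mathcal G,\mathcal A_0)$ is conditionally benign. -/

import Mathlib

open MeasureTheory ProbabilityTheory

namespace CausalBandit

/-! ### Conditionally benign environments -/

/-- A family `ν` of joint distributions of (context, reward) is conditionally benign if there is a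
joint distribution `p` such that, for every action `a`, the context marginal of `ν a` is absolutely
continuous with respect to that of `p`, and the conditional distributions of the reward given the
context under `ν a` and under `p` agree `p`-almost surely. Conditional distributions are only
defined up to null sets, so the last clause says that some Markov kernel is a version of both. -/
def ConditionallyBenign {ι 𝒵 𝒴 : Type*} [MeasurableSpace 𝒵] [MeasurableSpace 𝒴]
    (ν : ι → Measure (𝒵 × 𝒴)) : Prop :=
  ∃ p : Measure (𝒵 × 𝒴), IsProbabilityMeasure p ∧
    ∀ a : ι, (ν a).fst ≪ p.fst ∧
      ∃ κ : Kernel 𝒵 𝒴, IsMarkovKernel κ ∧ (ν a).IsCondKernel κ ∧ p.IsCondKernel κ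

/-! ### Graphs and `d`-separation -/

/-- A directed acyclic graph on the nodes `V₁, …, V_M, Y`, where `some i` is the `i`-th variable
and `none` is the reward `Y`. The variables are listed in a topological order (which makes the
graph acyclic), and `Y` is a leaf. -/
structure CausalBanditGraph (M : ℕ) where
  /-- `Arrow u v` means that there is a directed edge from `u` to `v`. -/
  Arrow : Option (Fin M) → Option (Fin M) → Prop
  lt_of_arrow : ∀ i j : Fin M, Arrow (some i) (some j) → i < j
  leaf : ∀ v : Option (Fin M), ¬ Arrow none v

namespace CausalBanditGraph

variable {M : ℕ}

open Classical in
/-- The graphical parents of a node (the reward is nobody's parent). -/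
noncomputable def parents (G : CausalBanditGraph M) (v : Option (Fin M)) : Finset (Fin M) :=
  Finset.univ.filter fun i => G.Arrow (some i) v

/-- The graph with all edges directed into `A` removed. -/
def mutilate (G : CausalBanditGraph M) (A : Finset (Fin M)) : CausalBanditGraph M where
  Arrow u v := G.Arrow u v ∧ ∀ i ∈ A, v ≠ some i
  lt_of_arrow i j h := G.lt_of_arrow i j h.1
  leaf v h := G.leaf v h.1

/-- The underlying undirected graph. -/
def skeleton (G : CausalBanditGraph M) : SimpleGraph (Option (Fin M)) :=
  SimpleGraph.fromRel G.Arrow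

/-- `IsDescendant G b d`: the node `d` is a descendant of `b` (possibly `b` itself). -/
def IsDescendant (G : CausalBanditGraph M) (b d : Option (Fin M)) : Prop :=
  Relation.ReflTransGen G.Arrow b d

/-- A path, given by its list of nodes, is blocked by `Z` if it contains consecutive nodes
`u, b, w` such that either (a) they form a chain (in either direction) or a fork with `b ∈ Z`, or
(b) they form a collider `u → b ← w` and no descendant of `b`, including `b`, is in `Z`. -/
def Blocked (G : CausalBanditGraph M) (Z : Finset (Fin M)) (l : List (Option (Fin M))) : Prop :=
  ∃ u b w : Option (Fin M), [u, b, w] <:+: l ∧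
    ((((G.Arrow u b ∧ G.Arrow b w) ∨ (G.Arrow b u ∧ G.Arrow w b) ∨ (G.Arrow b u ∧ G.Arrow b w)) ∧
        ∃ k ∈ Z, b = some k) ∨
      ((G.Arrow u b ∧ G.Arrow w b) ∧ ∀ k ∈ Z, ¬ G.IsDescendant b (some k)))

/-- `Z` `d`-separates the reward from `A`: every path between `A` and the reward is blocked. -/
def DSeparates (G : CausalBanditGraph M) (Z A : Finset (Fin M)) : Prop :=
  ∀ i ∈ A, ∀ π : G.skeleton.Walk (some i) none, π.IsPath → G.Blocked Z π.support

end CausalBanditGraph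

/-! ### Distributions on the nodes -/

section Distributions

variable {M : ℕ} (X : Fin M → Type*)

/-- The joint sample space of the variables `V₁, …, V_M` and the `[0,1]`-valued reward. -/
abbrev Outcome := (∀ i, X i) × unitInterval

variable {X} [∀ i, MeasurableSpace (X i)]

/-- The event that the variables with index in `S` take the same values as in `x`. -/
def agree (S : Finset (Fin M)) (x : ∀ i, X i) : Set (Outcome X) :=
  {ω | ∀ i ∈ S, ω.1 i = x i}

/-- `p` is a probability distribution on the nodes such that every joint value of `V₁, …, V_M`
has strictly positive probability. -/
def IsPositive (p : Measure (Outcome X)) : Prop :=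
  IsProbabilityMeasure p ∧ ∀ x : ∀ i, X i, 0 < p {ω | ω.1 = x}

/-- Under `p`, the random element `f` is conditionally independent of `(V_j)_{j ∈ T}` given the
discrete variables `(V_j)_{j ∈ S}`: they are independent given each value of the latter. -/
def CondIndepGiven {β : Type*} [MeasurableSpace β] (p : Measure (Outcome X)) (f : Outcome X → β)
    (T S : Finset (Fin M)) : Prop :=
  ∀ x : ∀ i, X i, IndepFun f (fun ω => T.restrict ω.1) p[|agree S x]

/-- `S` is a minimum-cardinality subset of `pre` such that `f` is conditionally independent under
`p` of `pre \ S` given `S`. (For positive `p` such a set is unique.) -/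
def IsMarkovianParents {β : Type*} [MeasurableSpace β] (p : Measure (Outcome X))
    (f : Outcome X → β) (pre S : Finset (Fin M)) : Prop :=
  S ⊆ pre ∧ CondIndepGiven p f (pre \ S) S ∧
    ∀ T ⊆ pre, CondIndepGiven p f (pre \ T) T → S.card ≤ T.card

/-- `p` is Markov relative to `G`: the Markovian parents of each node under `p` (among the
variables preceding it; all variables precede the reward) are graphical parents of it. -/
def MarkovRelative (p : Measure (Outcome X)) (G : CausalBanditGraph M) : Prop :=
  (∀ i : Fin M, ∃ S, IsMarkovianParents p (fun ω => ω.1 i) (Finset.Iio i) S ∧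
      S ⊆ G.parents (some i)) ∧
    ∃ S, IsMarkovianParents p (fun ω => ω.2) Finset.univ S ∧ S ⊆ G.parents none

/-! ### Interventions -/

variable (X) in
/-- An intervention: `a i = some v` means that `V_i` is set to `v`, and `a i = none` that `V_i` is
not intervened on. -/
abbrev Intervention := ∀ i, Option (X i)

variable (X) in
/-- The null (purely observational) intervention. -/
def nullIntervention : Intervention X := fun _ => none

variable (X) in
/-- All interventions on `A`: the interventions `do(A = a)`, for all joint values `a` of `A`, and
the null intervention. -/
def interventionsOn (A : Finset (Fin M)) : Set (Intervention X) :=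
  {a | ∀ i, a i ≠ none ↔ i ∈ A} ∪ {nullIntervention X}

variable [∀ i, Fintype (X i)]

open Classical in
/-- The interventional distribution: the measure under which `V = x` and `Y ∈ B` has mass
`𝟙{x agrees with a} * p(Y ∈ B | PA_Y = x) * ∏ p(V_i = x_i | PA_i = x)`, the product being over the
variables that are not intervened on. -/
noncomputable def interventional (G : CausalBanditGraph M) (p : Measure (Outcome X))
    (a : Intervention X) : Measure (Outcome X) :=
  ∑ x : ∀ i, X i,
    (if ∀ i, a i ≠ none → a i = some (x i) then
        ∏ i ∈ Finset.univ.filter (fun i => a i = none),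
          p[{ω | ω.1 i = x i} | agree (G.parents (some i)) x]
      else 0) •
      (Measure.dirac x).prod ((p[|agree (G.parents none) x]).map Prod.snd)

/-- `(G, 𝒜)` is conditionally benign, with post-action context `Z`: for each positive distribution
that is Markov relative to `G`, the interventional distributions of `(Z, Y)` under the interventions
in `𝒜` form a conditionally benign environment. -/
def GraphConditionallyBenign (G : CausalBanditGraph M) (Z : Finset (Fin M))
    (𝒜 : Set (Intervention X)) : Prop :=
  ∀ p : Measure (Outcome X), IsPositive p → MarkovRelative p G →
    ConditionallyBenign fun a : 𝒜 =>
      (interventional G p a).map fun ω => (Z.restrict ω.1, ω.2)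

end Distributions

end CausalBandit

/-! Both directions pass through `Reach`: the nodes reached from `A` by walks whose interior
colliders are exactly their interior nodes in `Z`. Such a walk may descend from a collider to `Z`
and climb back, so `Reach` captures ordinary d-connection, and `dSeparates_iff_not_reach` turns
d-separation into `Y` not being reached.

Separation implies benignity by an exchange argument. Every action gives every context positive
mass, so it suffices to prove `p_a(z, B) p_a'(z) = p_a'(z, B) p_a(z)`. Sum out the nodes that are
not ancestors of `Z` or `Y`, write each side as a sum over pairs of outcomes with context `z`, and
swap the reached coordinates outside `Z` within each pair. By `reach_family`, the family (a node
with its parents) of each remaining node outside `A` is, up to coordinates in `Z` where the two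
outcomes agree, swapped entirely or not at all; the kernels therefore just change places. The nodes
of `A` are swapped and the parents of `Y` are not, so the two sides agree
(`sum_setKernel_mul_comm`).

Conversely, suppose `Y` is reached. A shortest walk splits into nodes `P` that carry a bit from some
`a` in `A` to `Y`, and loops `F` running down to `Z` and back (`Reach.exists_isConnection`). Let
nodes of `P` copy the bit along arrows, and let nodes of `F` report to `Z` whether their parents in
`P` agree. In the context where all reports are positive, the reward equals the bit of `a`, so its
conditional law depends on the action. These kernels have zeros. Positive kernels define positive
Markov distributions (the `modelMeasure` lemmas), for which benignity is a polynomial identity in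
the kernels; the identity survives limits (`GraphConditionallyBenign.mass_mul_mass`) and fails for
the kernels above. -/

namespace CausalBandit

/-! ### Trails in an asymmetric relation -/

section Trails

variable {V : Type*} {R : V → V → Prop} {Q : V → V → V → Prop} {Z A : Set V}

/-- `w 0, …, w n` are consecutively adjacent (in either direction), and each three consecutive
nodes satisfy `Q`. -/
def IsTrail (R : V → V → Prop) (Q : V → V → V → Prop) (w : ℕ → V) (n : ℕ) : Prop :=
  (∀ k < n, R (w k) (w (k + 1)) ∨ R (w (k + 1)) (w k)) ∧
    ∀ k, k + 1 < n → Q (w k) (w (k + 1)) (w (k + 2))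

/-- The middle node is a collider exactly when it lies in `Z`. -/
def StronglyActive (R : V → V → Prop) (Z : Set V) (u b v : V) : Prop :=
  (R u b ∧ R v b) ↔ b ∈ Z

/-- A collider has a descendant in `Z`; a middle node that is not a collider is not in `Z`. -/
def WeaklyActive (R : V → V → Prop) (Z : Set V) (u b v : V) : Prop :=
  ((R u b ∧ R v b) → ∃ z ∈ Z, Relation.ReflTransGen R b z) ∧ (¬ (R u b ∧ R v b) → b ∉ Z)

theorem StronglyActive.weaklyActive {u b v : V} (h : StronglyActive R Z u b v) :
    WeaklyActive R Z u b v :=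
  ⟨fun hc => ⟨b, h.1 hc, .refl⟩, fun hc hb => hc (h.2 hb)⟩

theorem StronglyActive.symm {u b v : V} (h : StronglyActive R Z u b v) :
    StronglyActive R Z v b u := by
  unfold StronglyActive at *; rw [and_comm, h]

theorem IsTrail.mono {Q' : V → V → V → Prop} {w : ℕ → V} {n : ℕ} (h : IsTrail R Q w n)
    (hQ : ∀ u b v, Q u b v → Q' u b v) : IsTrail R Q' w n :=
  ⟨h.1, fun k hk => hQ _ _ _ (h.2 k hk)⟩

theorem IsTrail.take {w : ℕ → V} {n m : ℕ} (h : IsTrail R Q w n) (hm : m ≤ n) :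
    IsTrail R Q w m :=
  ⟨fun k hk => h.1 k (by omega), fun k hk => h.2 k (by omega)⟩

theorem IsTrail.drop {w : ℕ → V} {n : ℕ} (h : IsTrail R Q w n) (m : ℕ) :
    IsTrail R Q (fun k => w (m + k)) (n - m) :=
  ⟨fun k hk => h.1 (m + k) (by omega), fun k hk => h.2 (m + k) (by omega)⟩

theorem IsTrail.reverse {w : ℕ → V} {n : ℕ} (h : IsTrail R Q w n)
    (hQ : ∀ u b v, Q u b v → Q v b u) : IsTrail R Q (fun k => w (n - k)) n := by
  refine ⟨fun k hk => ?_, fun k hk => ?_⟩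
  · obtain ⟨m, rfl⟩ : ∃ m, n = k + 1 + m := ⟨n - (k + 1), by omega⟩
    have h1 : k + 1 + m - k = m + 1 := by omega
    have h2 : k + 1 + m - (k + 1) = m := by omega
    simp only [h1, h2]
    exact (h.1 m (by omega)).symm
  · obtain ⟨m, rfl⟩ : ∃ m, n = k + 2 + m := ⟨n - (k + 2), by omega⟩
    have h1 : k + 2 + m - k = m + 2 := by omega
    have h2 : k + 2 + m - (k + 1) = m + 1 := by omega
    have h3 : k + 2 + m - (k + 2) = m := by omega
    simp only [h1, h2, h3]
    exact hQ _ _ _ (h.2 m (by omega))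

/-- The concatenation of two sequences. -/
def appendSeq (w₁ : ℕ → V) (n₁ : ℕ) (w₂ : ℕ → V) : ℕ → V :=
  fun k => if k < n₁ then w₁ k else w₂ (k - n₁)

theorem appendSeq_add (w₁ : ℕ → V) (n₁ : ℕ) (w₂ : ℕ → V) (k : ℕ) :
    appendSeq w₁ n₁ w₂ (n₁ + k) = w₂ k := by
  simp [appendSeq]

theorem appendSeq_of_le {w₁ : ℕ → V} {n₁ : ℕ} {w₂ : ℕ → V} (h : w₁ n₁ = w₂ 0) {k : ℕ}
    (hk : k ≤ n₁) : appendSeq w₁ n₁ w₂ k = w₁ k := by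
  unfold appendSeq
  rcases hk.lt_or_eq with h1 | rfl
  · simp [h1]
  · simp [h]

theorem IsTrail.append {w₁ w₂ : ℕ → V} {n₁ n₂ : ℕ} (h₁ : IsTrail R Q w₁ n₁)
    (h₂ : IsTrail R Q w₂ n₂) (h : w₁ n₁ = w₂ 0)
    (hQ : 0 < n₁ → 0 < n₂ → Q (w₁ (n₁ - 1)) (w₁ n₁) (w₂ 1)) :
    IsTrail R Q (appendSeq w₁ n₁ w₂) (n₁ + n₂) := by
  refine ⟨fun k hk => ?_, fun k hk => ?_⟩
  · rcases lt_or_ge k n₁ with hk1 | hk1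
    · rw [appendSeq_of_le h hk1.le, appendSeq_of_le h (by omega)]
      exact h₁.1 k hk1
    · obtain ⟨m, rfl⟩ := Nat.exists_eq_add_of_le hk1
      rw [add_assoc, appendSeq_add, appendSeq_add]
      exact h₂.1 m (by omega)
  · rcases lt_trichotomy (k + 1) n₁ with hk1 | hk1 | hk1
    · rw [appendSeq_of_le h (by omega), appendSeq_of_le h (by omega),
        appendSeq_of_le h (by omega)]
      exact h₁.2 k hk1
    · rw [appendSeq_of_le h (by omega), appendSeq_of_le h (by omega),
        show k + 2 = n₁ + 1 by omega, appendSeq_add]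
      have := hQ (by omega) (by omega)
      subst hk1
      simpa using this
    · obtain ⟨m, rfl⟩ : ∃ m, k = n₁ + m := ⟨k - n₁, by omega⟩
      rw [add_assoc, appendSeq_add, appendSeq_add, add_assoc, appendSeq_add]
      exact h₂.2 m (by omega)

/-! ### Reachability and d-connecting trails -/

/-- Nodes that can be reached from `A` along a trail on which the colliders are the nodes in `Z`;
the index records whether the last step follows an arrow (`true`) or goes against it. -/
inductive Reach (R : V → V → Prop) (Z A : Set V) : Bool → V → Prop
  | start {a : V} : a ∈ A → Reach R Z A false a
  | child {d : Bool} {u v : V} : Reach R Z A d u → u ∉ Z → R u v → Reach R Z A true v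
  | parent {u v : V} : Reach R Z A false v → v ∉ Z → R u v → Reach R Z A false u
  | collider {u v : V} : Reach R Z A true v → v ∈ Z → R u v → Reach R Z A false u

/-- Descend to the first node in `Z`, turn there, and climb back the same way. Colliders may thus be
required to lie in `Z` themselves, at the price of repeated nodes. -/
theorem Reach.parent_of_descendant {u v z : V} (h : Reach R Z A true v) (hz : z ∈ Z)
    (hd : Relation.ReflTransGen R v z) (huv : R u v) : Reach R Z A false u := by
  induction hd using Relation.ReflTransGen.head_induction_on generalizing u with
  | refl => exact .collider h hz huv
  | @head b _ hab _ ih =>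
    by_cases hb : b ∈ Z
    · exact .collider h hb huv
    · exact .parent (ih (.child h hb hab) hab) hb huv

theorem Reach.exists_isTrail (hR : ∀ u v, R u v → ¬ R v u) {d : Bool} {v : V}
    (h : Reach R Z A d v) :
    ∃ w n, IsTrail R (StronglyActive R Z) w n ∧ w 0 ∈ A ∧ w n = v ∧
      (d = true → 0 < n ∧ R (w (n - 1)) v) ∧ (d = false → 0 < n → R v (w (n - 1))) := by
  have key : ∀ (w : ℕ → V) (n : ℕ) (v : V), IsTrail R (StronglyActive R Z) w n →
      (R (w n) v ∨ R v (w n)) → (0 < n → StronglyActive R Z (w (n - 1)) (w n) v) →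
      ∃ w', IsTrail R (StronglyActive R Z) w' (n + 1) ∧ w' 0 = w 0 ∧ w' (n + 1) = v ∧
        w' n = w n := by
    intro w n v hw hv hQ
    have h0 : w n = (fun k => if k = 0 then w n else v) 0 := by simp
    refine ⟨appendSeq w n (fun k => if k = 0 then w n else v), hw.append (n₂ := 1) ⟨?_, ?_⟩ h0 ?_,
      appendSeq_of_le h0 (by omega), ?_, appendSeq_of_le h0 le_rfl⟩
    · intro k hk
      obtain rfl : k = 0 := by omega
      simpa using hv
    · intro k hk; omega
    · intro hn _
      simpa using hQ hn
    · rw [appendSeq_add]; simp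
  induction h with
  | start ha => exact ⟨fun _ => _, 0, ⟨by simp, by simp⟩, ha, rfl, by simp, by simp⟩
  | @child d u v h hu huv ih =>
    obtain ⟨w, n, hw, hA, rfl, h1, h2⟩ := ih
    obtain ⟨w', hw', h0, hv, hn⟩ := key w n v hw (.inl huv) (fun hn => by
      have := hR _ _ huv
      simp [StronglyActive, hu, this])
    exact ⟨w', n + 1, hw', h0 ▸ hA, hv, by simp [hn, huv], by simp⟩
  | @parent u v h hv huv ih =>
    obtain ⟨w, n, hw, hA, rfl, h1, h2⟩ := ih
    obtain ⟨w', hw', h0, hv, hn⟩ := key w n u hw (.inr huv) (fun hn => by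
      have := hR _ _ (h2 rfl hn)
      simp [StronglyActive, hv, this])
    exact ⟨w', n + 1, hw', h0 ▸ hA, hv, by simp, by simp [hn, huv]⟩
  | @collider u v h hv huv ih =>
    obtain ⟨w, n, hw, hA, rfl, h1, h2⟩ := ih
    obtain ⟨w', hw', h0, hv, hn⟩ := key w n u hw (.inr huv) (fun hn => by
      simp [StronglyActive, hv, huv, (h1 rfl).2])
    exact ⟨w', n + 1, hw', h0 ▸ hA, hv, by simp, by simp [hn, huv]⟩

theorem IsTrail.reach (hR : ∀ u v, R u v → ¬ R v u) (hZA : Disjoint Z A) {w : ℕ → V} {n : ℕ}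
    (hw : IsTrail R (WeaklyActive R Z) w n) (h0 : w 0 ∈ A) : ∃ d, Reach R Z A d (w n) := by
  have key : ∀ k ≤ n, (k = 0 → Reach R Z A false (w k)) ∧
      (0 < k → R (w (k - 1)) (w k) → Reach R Z A true (w k)) ∧
      (0 < k → R (w k) (w (k - 1)) → Reach R Z A false (w k)) := by
    intro k
    induction k with
    | zero => exact fun _ => ⟨fun _ => .start h0, by simp, by simp⟩
    | succ k ih =>
      intro hk
      obtain ⟨i0, i1, i2⟩ := ih (by omega)
      simp only [Nat.add_sub_cancel]
      refine ⟨by omega, fun _ hr => ?_, fun _ hr => ?_⟩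
      · rcases Nat.eq_zero_or_pos k with rfl | hpos
        · exact .child (i0 rfl) (fun hz => Set.disjoint_left.1 hZA hz h0) hr
        · have hq := hw.2 (k - 1) (by omega)
          rw [show k - 1 + 1 = k by omega, show k - 1 + 2 = k + 1 by omega] at hq
          have hz : w k ∉ Z := hq.2 fun h => hR _ _ hr h.2
          have ha := hw.1 (k - 1) (by omega)
          rw [show k - 1 + 1 = k by omega] at ha
          rcases ha with ha | ha
          · exact .child (i1 hpos ha) hz hr
          · exact .child (i2 hpos ha) hz hr
      · rcases Nat.eq_zero_or_pos k with rfl | hpos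
        · exact .parent (i0 rfl) (fun hz => Set.disjoint_left.1 hZA hz h0) hr
        · have hq := hw.2 (k - 1) (by omega)
          rw [show k - 1 + 1 = k by omega, show k - 1 + 2 = k + 1 by omega] at hq
          have ha := hw.1 (k - 1) (by omega)
          rw [show k - 1 + 1 = k by omega] at ha
          rcases ha with ha | ha
          · obtain ⟨z, hz, hd⟩ := hq.1 ⟨ha, hr⟩
            exact (i1 hpos ha).parent_of_descendant hz hd hr
          · exact .parent (i2 hpos ha) (hq.2 fun h => hR _ _ ha h.1) hr
  obtain ⟨i0, i1, i2⟩ := key n le_rfl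
  rcases Nat.eq_zero_or_pos n with rfl | hpos
  · exact ⟨_, i0 rfl⟩
  · have ha := hw.1 (n - 1) (by omega)
    rw [show n - 1 + 1 = n by omega] at ha
    rcases ha with ha | ha
    · exact ⟨_, i1 hpos ha⟩
    · exact ⟨_, i2 hpos ha⟩

/-! ### Shortest trails -/

theorem exists_shortest_isTrail {w : ℕ → V} {n : ℕ} {y : V} (hw : IsTrail R Q w n)
    (h0 : w 0 ∈ A) (hy : w n = y) :
    ∃ w n, IsTrail R Q w n ∧ w 0 ∈ A ∧ w n = y ∧
      ∀ w' n', IsTrail R Q w' n' → w' 0 ∈ A → w' n' = y → n ≤ n' := by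
  classical
  have hex : ∃ n, ∃ w, IsTrail R Q w n ∧ w 0 ∈ A ∧ w n = y := ⟨n, w, hw, h0, hy⟩
  obtain ⟨w', h1, h2, h3⟩ := Nat.find_spec hex
  exact ⟨w', _, h1, h2, h3, fun w'' n' a b c => Nat.find_min' hex ⟨w'', a, b, c⟩⟩

/-- In a shortest trail, a repeated node cannot be cut out. -/
theorem IsTrail.not_of_eq {w : ℕ → V} {n : ℕ} {y : V} (hw : IsTrail R Q w n)
    (h0 : w 0 ∈ A) (hy : w n = y)
    (hmin : ∀ w' n', IsTrail R Q w' n' → w' 0 ∈ A → w' n' = y → n ≤ n') {i j : ℕ}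
    (hij : i < j) (hj : j ≤ n) (h : w i = w j) :
    0 < i ∧ j < n ∧ ¬ Q (w (i - 1)) (w i) (w (j + 1)) := by
  have hi : 0 < i := by
    rcases Nat.eq_zero_or_pos i with rfl | hi
    · have := hmin _ _ (hw.drop j) (by simpa [← h] using h0)
        (by simp [show j + (n - j) = n by omega, hy])
      omega
    · exact hi
  have hjn : j < n := by
    rcases hj.lt_or_eq with hj | rfl
    · exact hj
    · have := hmin _ _ (hw.take hij.le) h0 (h.trans hy)
      omega
  refine ⟨hi, hjn, fun hQ => ?_⟩
  have hw' := (hw.take (hij.le.trans hj)).append (hw.drop j) (by simpa using h)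
    (fun _ _ => hQ)
  have := hmin _ _ hw' (by rwa [appendSeq_of_le (by simpa using h) (by omega)])
    (by rw [appendSeq_add]; simp [show j + (n - j) = n by omega, hy])
  omega

/-- A shortest weakly active trail has no repetition: cutting a repeated node out must deactivate
the junction, which can only happen if the junction becomes a collider without descendants in `Z`.
The trail cannot turn around below such a node, so it leaves even the second visit downwards,
against the arrow that enters there. -/
theorem exists_injOn_isTrail (hR : ∀ u v, R u v → ¬ R v u) {d : Bool} {y : V}
    (h : Reach R Z A d y) :
    ∃ w n, IsTrail R (WeaklyActive R Z) w n ∧ w 0 ∈ A ∧ w n = y ∧ Set.InjOn w (Set.Iic n) := by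
  obtain ⟨w, n, hw, h0, hy, -⟩ := h.exists_isTrail hR
  obtain ⟨w, n, hw, h0, hy, hmin⟩ :=
    exists_shortest_isTrail (hw.mono fun _ _ _ => StronglyActive.weaklyActive) h0 hy
  refine ⟨w, n, hw, h0, hy, ?_⟩
  have key : ∀ i j, i < j → j ≤ n → w i ≠ w j := by
    intro i j hij hj h
    obtain ⟨hi, hjn, hQ⟩ := hw.not_of_eq h0 hy hmin hij hj h
    have hqi := hw.2 (i - 1) (by omega)
    rw [show i - 1 + 1 = i by omega, show i - 1 + 2 = i + 1 by omega] at hqi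
    have hqj := hw.2 (j - 1) (by omega)
    rw [show j - 1 + 1 = j by omega, show j - 1 + 2 = j + 1 by omega] at hqj
    -- If the junction is not a collider, it can only be inactive by lying in `Z`; but then both
    -- visits are colliders, and so is the junction.
    have hc : R (w (i - 1)) (w i) ∧ R (w (j + 1)) (w i) := by
      by_contra hc
      refine hQ ⟨fun h => absurd h hc, fun _ hz => ?_⟩
      have h1 : R (w (i - 1)) (w i) ∧ R (w (i + 1)) (w i) := by
        by_contra h1; exact hqi.2 h1 hz
      have h2 : R (w (j - 1)) (w j) ∧ R (w (j + 1)) (w j) := by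
        by_contra h2; exact hqj.2 h2 (h ▸ hz)
      exact hc ⟨h1.1, h ▸ h2.2⟩
    have hD : ¬ ∃ z ∈ Z, Relation.ReflTransGen R (w i) z := fun hD =>
      hQ ⟨fun _ => hD, fun h => absurd hc h⟩
    -- The first upward turn would be a collider below `w i`, hence `w i` would have a descendant in
    -- `Z`.
    have hdown : ∀ t, i + t ≤ j →
        Relation.ReflTransGen R (w i) (w (i + t)) ∧ R (w (i + t)) (w (i + t + 1)) := by
      intro t
      induction t with
      | zero =>
        intro _
        refine ⟨.refl, ?_⟩
        rcases hw.1 i (by omega) with h1 | h1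
        · exact h1
        · exact absurd (hqi.1 ⟨hc.1, h1⟩) hD
      | succ t ih =>
        intro ht
        obtain ⟨a, b⟩ := ih (by omega)
        have a' : Relation.ReflTransGen R (w i) (w (i + (t + 1))) := a.tail b
        refine ⟨a', ?_⟩
        rcases hw.1 (i + (t + 1)) (by omega) with h1 | h1
        · exact h1
        · obtain ⟨z, hz, hd⟩ := (hw.2 (i + t) (by omega)).1 ⟨b, h1⟩
          exact absurd ⟨z, hz, a'.trans hd⟩ hD
    have h1 := (hdown (j - i) (by omega)).2
    rw [show i + (j - i) = j by omega] at h1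
    exact hR _ _ h1 (h ▸ hc.2)
  intro i hi j hj h
  rcases lt_trichotomy i j with h1 | h1 | h1
  · exact absurd h (key i j h1 hj)
  · exact h1
  · exact absurd h.symm (key j i h1 hi)

/-! ### Connections that transmit a signal -/

/-- `C` is a connection from `a` to `y`: nodes `P` that carry a signal, `Pr v u` saying that `v`
copies the signal of its parent `u`, and a set `F` of nodes that pass on to `Z` whether the signals
of their parents in `P` agree. -/
structure IsConnection (R : V → V → Prop) (Z A : Set V) (y a : V) (P F : Set V)
    (Pr : V → V → Prop) : Prop where
  mem : a ∈ P
  disjoint : Disjoint P F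
  disjoint_Z : Disjoint P Z
  eq_of_mem : ∀ v, v ∈ P ∨ v ∈ F → v ∈ A → v = a
  of_pr : ∀ v u, Pr v u → u ∈ P ∧ v ∈ P ∧ R u v
  pr_unique : ∀ v u u', Pr v u → Pr v u' → u = u'
  exists_pr : ∃ u, Pr y u
  exists_child : ∀ v ∈ F, v ∈ Z ∨ ∃ c ∈ F, R v c
  eq_signal : ∀ β : V → Bool, (∀ v u, Pr v u → β v = β u) →
    (∀ c ∈ F, ∀ u ∈ P, ∀ v ∈ P, R u c → R v c → β u = β v) → β y = β a

/-- A shortest strongly active trail repeats a node only by descending from it and climbing back to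
it. These loops and the colliders make up `F`. On the remaining part `P` there are no colliders, so
each node copies from at most one parent. Loops do not cross, so the stretch between two pieces of
`P` is a single loop, entered and left through two parents of the same node; their agreement carries
the signal across. -/
theorem Reach.exists_isConnection (hR : ∀ u v, R u v → ¬ R v u) (hZA : Disjoint Z A) {y : V}
    (hyZ : y ∉ Z) (hyA : y ∉ A) (hleaf : ∀ v, ¬ R y v) {d : Bool} (h : Reach R Z A d y) :
    ∃ a ∈ A, ∃ P F Pr, IsConnection R Z A y a P F Pr := by
  obtain ⟨w, n, hw, h0, hy, -⟩ := h.exists_isTrail hR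
  obtain ⟨w, n, hw, h0, hy, hmin⟩ := exists_shortest_isTrail hw h0 hy
  have hmid : ∀ k, 0 < k → k < n → StronglyActive R Z (w (k - 1)) (w k) (w (k + 1)) := by
    intro k hk hkn
    have := hw.2 (k - 1) (by omega)
    rwa [show k - 1 + 1 = k by omega, show k - 1 + 2 = k + 1 by omega] at this
  have hadj : ∀ k, 0 < k → k ≤ n → R (w (k - 1)) (w k) ∨ R (w k) (w (k - 1)) := by
    intro k hk hkn
    have := hw.1 (k - 1) (by omega)
    rwa [show k - 1 + 1 = k by omega] at this
  have hnA : ∀ k, 0 < k → k ≤ n → w k ∉ A := by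
    intro k hk hkn hA
    have := hmin _ _ (hw.drop k) hA (by simp [show k + (n - k) = n by omega, hy])
    omega
  have hrep : ∀ i j, i < j → j ≤ n → w i = w j → 0 < i ∧ j < n ∧ w i ∉ Z ∧
      R (w (i - 1)) (w i) ∧ R (w (j + 1)) (w j) ∧ R (w i) (w (i + 1)) ∧
        R (w j) (w (j - 1)) := by
    intro i j hij hj h
    obtain ⟨hi, hjn, hQ⟩ := hw.not_of_eq h0 hy hmin hij hj h
    have hqi := hmid i hi (by omega)
    have hqj := hmid j (by omega) hjn
    have hz : w i ∉ Z := by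
      intro hz
      have h1 := hqi.2 hz
      have h2 := hqj.2 (h ▸ hz)
      exact hQ ⟨fun _ => hz, fun _ => ⟨h1.1, h ▸ h2.2⟩⟩
    have hc : R (w (i - 1)) (w i) ∧ R (w (j + 1)) (w i) := by
      by_contra hc
      exact hQ ⟨fun h => absurd h hc, fun h => absurd h hz⟩
    refine ⟨hi, hjn, hz, hc.1, h ▸ hc.2, ?_, ?_⟩
    · rcases hw.1 i (by omega) with h1 | h1
      · exact h1
      · exact absurd (hqi.1 ⟨hc.1, h1⟩) hz
    · rcases hadj j (by omega) hj with h1 | h1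
      · exact absurd (hqj.1 ⟨h1, h ▸ hc.2⟩) (h ▸ hz)
      · exact h1
  -- The case `i = j` is allowed and is a single collider, which lies in `Z`.
  let Loop : ℕ → ℕ → Prop := fun i j =>
    0 < i ∧ i ≤ j ∧ j < n ∧ w i = w j ∧ R (w (i - 1)) (w i) ∧ R (w (j + 1)) (w j)
  let I : ℕ → Prop := fun k => ∃ i j, Loop i j ∧ i ≤ k ∧ k ≤ j
  have hloop : ∀ i j, i < j → j ≤ n → w i = w j → Loop i j := fun i j hij hj h => by
    obtain ⟨a, b, _, c, d, _⟩ := hrep i j hij hj h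
    exact ⟨a, hij.le, b, h, c, d⟩
  have hIn : ∀ k, I k → 0 < k ∧ k < n := by
    rintro k ⟨i, j, ⟨h1, h2, h3, -⟩, h4, h5⟩
    omega
  have hZI : ∀ k ≤ n, w k ∈ Z → I k := by
    intro k hk hz
    have hk0 : 0 < k := by
      rcases Nat.eq_zero_or_pos k with rfl | hk0
      · exact absurd h0 (Set.disjoint_left.1 hZA hz)
      · exact hk0
    have hkn : k < n := by
      rcases hk.lt_or_eq with hk | rfl
      · exact hk
      · exact absurd (hy ▸ hz) hyZ
    have := (hmid k hk0 hkn).2 hz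
    exact ⟨k, k, ⟨hk0, le_rfl, hkn, rfl, this.1, this.2⟩, le_rfl, le_rfl⟩
  have hIeq : ∀ k l, k ≤ n → l ≤ n → w k = w l → ¬ I k → k = l := by
    intro k l hk hl h hI
    rcases lt_trichotomy k l with h1 | h1 | h1
    · exact absurd ⟨k, l, hloop k l h1 hl h, le_rfl, h1.le⟩ hI
    · exact h1
    · exact absurd ⟨l, k, hloop l k h1 hk h.symm, h1.le, le_rfl⟩ hI
  have htriple : ∀ i j k, i < j → j < k → k ≤ n → w i = w j → w j = w k → False := by
    intro i j k hij hjk hk h1 h2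
    obtain ⟨-, -, -, -, a, -⟩ := hrep i j hij (by omega) h1
    obtain ⟨-, -, -, -, -, b, -⟩ := hrep j k hjk hk h2
    exact hR _ _ a b
  -- If two loops crossed, one could follow the trail to `i₁`, run backwards from `j₁` to `i`, and
  -- continue from `j`. Both junctions are non-colliders outside `Z`, so this is a shorter active
  -- trail.
  have hcross : ∀ i₁ i j₁ j, i₁ < i → i ≤ j₁ → j₁ < j → Loop i₁ j₁ → Loop i j → False := by
    intro i₁ i j₁ j h1 h2 h3 l1 l2
    rcases h2.eq_or_lt with rfl | h2
    · exact htriple i₁ i j h1 h3 l2.2.2.1.le l1.2.2.2.1 l2.2.2.2.1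
    have hjn := l2.2.2.1
    have r1 := hrep i₁ j₁ (by omega) (by omega) l1.2.2.2.1
    have r2 := hrep i j (by omega) (by omega) l2.2.2.2.1
    have t2 := ((hw.take (m := j₁) (by omega)).drop i).reverse fun _ _ _ => StronglyActive.symm
    have e1 : w i₁ = (fun k => w (i + (j₁ - i - k))) 0 := by
      simp [show i + (j₁ - i) = j₁ by omega, l1.2.2.2.1]
    have t12 := (hw.take (m := i₁) (by omega)).append t2 e1 (by
      intro _ _
      simp only [show i + (j₁ - i - 1) = j₁ - 1 by omega]
      have := hR _ _ r1.2.2.2.2.2.2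
      rw [← l1.2.2.2.1] at this
      simp [StronglyActive, r1.2.2.1, this])
    have e2 : appendSeq w i₁ (fun k => w (i + (j₁ - i - k))) (i₁ + (j₁ - i)) =
        (fun k => w (j + k)) 0 := by
      rw [appendSeq_add]; simp [l2.2.2.2.1]
    have t123 := t12.append (hw.drop j) e2 (by
      intro _ _
      rw [appendSeq_add, show i₁ + (j₁ - i) - 1 = i₁ + (j₁ - i - 1) by omega, appendSeq_add]
      simp only [show i + (j₁ - i - (j₁ - i - 1)) = i + 1 by omega,
        show i + (j₁ - i - (j₁ - i)) = i by omega]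
      have := hR _ _ r2.2.2.2.2.2.1
      simp [StronglyActive, r2.2.2.1, this])
    have := hmin _ _ t123
      (by rwa [appendSeq_of_le e2 (by omega), appendSeq_of_le e1 (by omega)])
      (by rw [appendSeq_add]; simp [show j + (n - j) = n by omega, hy])
    omega
  have hn : 0 < n := by
    rcases Nat.eq_zero_or_pos n with rfl | hn
    · exact absurd (hy ▸ h0) hyA
    · exact hn
  let P : Set V := {v | ∃ k ≤ n, ¬ I k ∧ w k = v}
  let F : Set V := {v | ∃ k ≤ n, I k ∧ w k = v}
  let Pr : V → V → Prop := fun v u => ∃ k l, k ≤ n ∧ l ≤ n ∧ ¬ I k ∧ ¬ I l ∧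
    (l = k + 1 ∨ k = l + 1) ∧ w k = v ∧ w l = u ∧ R u v
  refine ⟨w 0, h0, P, F, Pr, ?_⟩
  refine ⟨⟨0, by omega, fun h => by have := hIn _ h; omega, rfl⟩, ?_, ?_, ?_, ?_, ?_, ?_, ?_, ?_⟩
  · rw [Set.disjoint_left]
    rintro v ⟨k, hk, hI, rfl⟩ ⟨l, hl, hI', h⟩
    exact hI (hIeq k l hk hl h.symm hI ▸ hI')
  · rw [Set.disjoint_left]
    rintro v ⟨k, hk, hI, rfl⟩ hz
    exact hI (hZI k hk hz)
  · have : ∀ k ≤ n, w k ∈ A → w k = w 0 := by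
      intro k hk hA
      rcases Nat.eq_zero_or_pos k with rfl | hk0
      · rfl
      · exact absurd hA (hnA k hk0 hk)
    rintro v (⟨k, hk, -, rfl⟩ | ⟨k, hk, -, rfl⟩) hA
    · exact this k hk hA
    · exact this k hk hA
  · rintro v u ⟨k, l, hk, hl, hIk, hIl, -, rfl, rfl, hr⟩
    exact ⟨⟨l, hl, hIl, rfl⟩, ⟨k, hk, hIk, rfl⟩, hr⟩
  · rintro v u u' ⟨k, l, hk, hl, hIk, hIl, hkl, rfl, rfl, hr⟩
      ⟨k', l', hk', hl', hIk', hIl', hkl', h, rfl, hr'⟩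
    obtain rfl := hIeq k k' hk hk' h.symm hIk
    by_contra hne
    have hll : l ≠ l' := fun h => hne (h ▸ rfl)
    apply hIk
    apply hZI k hk
    rcases hkl with rfl | rfl <;> rcases hkl' with h | h
    · omega
    · subst h
      exact (hmid (l' + 1) (by omega) (by omega)).1 ⟨hr', hr⟩
    · subst h
      exact (hmid (l + 1) (by omega) (by omega)).1 ⟨hr, hr'⟩
    · omega
  · have hr : R (w (n - 1)) (w n) := by
      rcases hadj n hn le_rfl with h1 | h1
      · exact h1
      · exact absurd (hy ▸ h1) (hleaf _)
    refine ⟨w (n - 1), n, n - 1, le_rfl, by omega, fun h => ?_, ?_, by omega, hy, rfl, hy ▸ hr⟩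
    · have := hIn _ h; omega
    · rintro ⟨i, j, ⟨h1, h2, h3, h4, h5, h6⟩, h7, h8⟩
      obtain rfl : j = n - 1 := by omega
      rw [show n - 1 + 1 = n by omega, hy] at h6
      exact hleaf _ h6
  · rintro v ⟨k, hk, ⟨i, j, ⟨h1, h2, h3, h4, h5, h6⟩, h7, h8⟩, rfl⟩
    by_cases hz : w k ∈ Z
    · exact .inl hz
    right
    have hq := hmid k (by omega) (by omega)
    have hl : R (w k) (w (k - 1)) → i < k → ∃ c ∈ F, R (w k) c := fun hr hik =>
      ⟨_, ⟨k - 1, by omega, ⟨i, j, ⟨h1, h2, h3, h4, h5, h6⟩, by omega, by omega⟩, rfl⟩, hr⟩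
    have hr : R (w k) (w (k + 1)) → k < j → ∃ c ∈ F, R (w k) c := fun hr hik =>
      ⟨_, ⟨k + 1, by omega, ⟨i, j, ⟨h1, h2, h3, h4, h5, h6⟩, by omega, by omega⟩, rfl⟩, hr⟩
    have hij : i < j := by
      rcases h2.lt_or_eq with h | rfl
      · exact h
      · obtain rfl : k = i := by omega
        exact absurd (hq.1 ⟨h5, h6⟩) hz
    rcases h7.eq_or_lt with rfl | h7
    · exact hr (hrep i j hij h3.le h4).2.2.2.2.2.1 hij
    rcases h8.eq_or_lt with rfl | h8
    · exact hl (hrep i k hij h3.le h4).2.2.2.2.2.2 hij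
    rcases hadj k (by omega) (by omega) with ha | ha
    · rcases hw.1 k (by omega) with hb | hb
      · exact hr hb h8
      · exact absurd (hq.1 ⟨ha, hb⟩) hz
    · exact hl ha h7
  · intro β hβ hβF
    have key : ∀ k, k ≤ n → ¬ I k → β (w k) = β (w 0) := by
      intro k
      induction k using Nat.strong_induction_on with
      | _ k ih =>
        intro hk hI
        rcases Nat.eq_zero_or_pos k with rfl | hk0
        · rfl
        by_cases hI' : I (k - 1)
        · obtain ⟨i, j, hl, h7, h8⟩ := hI'
          have hjk : j < k := by
            by_contra hjk
            exact hI ⟨i, j, hl, by omega, by omega⟩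
          obtain rfl : j = k - 1 := by omega
          obtain ⟨h1, h2, h3, h4, h5, h6⟩ := hl
          rw [show k - 1 + 1 = k by omega] at h6
          -- A loop covering `i - 1` but not `k` would end just before `i` against the arrow into `w
          -- i`, or cross the present loop, or end together with it. The last makes `w i` a node
          -- visited three times or a repeated collider.
          have hIi : ¬ I (i - 1) := by
            rintro ⟨i₁, j₁, hl₁, ha, hb⟩
            rcases lt_or_ge j₁ i with hj | hj
            · obtain rfl : j₁ = i - 1 := by omega
              have := hl₁.2.2.2.2.2
              rw [show i - 1 + 1 = i by omega] at this
              exact hR _ _ h5 this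
            have hjk' : j₁ < k := by
              by_contra hjk'
              exact hI ⟨i₁, j₁, hl₁, by omega, by omega⟩
            rcases lt_or_ge j₁ (k - 1) with hj' | hj'
            · exact hcross i₁ i j₁ (k - 1) (by omega) hj hj' hl₁
                ⟨h1, h2, h3, h4, h5, by rwa [show k - 1 + 1 = k by omega]⟩
            · obtain rfl : j₁ = k - 1 := by omega
              have h4' := hl₁.2.2.2.1
              rcases h2.eq_or_lt with h2 | h2
              · have hz := (hrep i₁ (k - 1) (by omega) (by omega) h4').2.2.1
                rw [h4'] at hz
                refine hz ((hmid (k - 1) (by omega) (by omega)).1 ⟨?_, ?_⟩)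
                · rw [← h2]; exact h5
                · rwa [show k - 1 + 1 = k by omega]
              · exact htriple i₁ i (k - 1) (by omega) h2 (by omega) (h4'.trans h4.symm) h4
          rw [← ih (i - 1) (by omega) (by omega) hIi]
          refine hβF (w i) ⟨i, by omega, ⟨i, k - 1, ⟨h1, h2, h3, h4, h5, ?_⟩, le_rfl, h2⟩, rfl⟩
            _ ⟨k, hk, hI, rfl⟩ _ ⟨i - 1, by omega, hIi, rfl⟩ (h4 ▸ h6) h5
          rwa [show k - 1 + 1 = k by omega]
        · rw [← ih (k - 1) (by omega) (by omega) hI']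
          rcases hadj k hk0 hk with ha | ha
          · exact hβ _ _ ⟨k, k - 1, hk, by omega, hI, hI', by omega, rfl, rfl, ha⟩
          · exact (hβ _ _ ⟨k - 1, k, by omega, hk, hI', hI, by omega, rfl, rfl, ha⟩).symm
    rw [← hy]
    exact key n le_rfl fun h => by have := hIn _ h; omega

end Trails

/-! ### d-separation as unreachability -/

namespace CausalBanditGraph

variable {M : ℕ} (G : CausalBanditGraph M)

theorem arrow_asymm (u v : Option (Fin M)) (h : G.Arrow u v) : ¬ G.Arrow v u := by
  intro h'
  cases u with
  | none => exact G.leaf _ h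
  | some i =>
    cases v with
    | none => exact G.leaf _ h'
    | some j => exact absurd (G.lt_of_arrow i j h) (G.lt_of_arrow j i h').asymm

theorem skeleton_adj {u v : Option (Fin M)} :
    G.skeleton.Adj u v ↔ G.Arrow u v ∨ G.Arrow v u := by
  simp only [skeleton, SimpleGraph.fromRel_adj, and_iff_right_iff_imp]
  rintro (h | h) rfl <;> exact G.arrow_asymm _ _ h h

theorem weaklyActive_iff (Z : Finset (Fin M)) {u b v : Option (Fin M)}
    (hu : G.Arrow u b ∨ G.Arrow b u) (hv : G.Arrow b v ∨ G.Arrow v b) :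
    WeaklyActive G.Arrow (some '' (Z : Set (Fin M))) u b v ↔
      ¬ ((((G.Arrow u b ∧ G.Arrow b v) ∨ (G.Arrow b u ∧ G.Arrow v b) ∨
          (G.Arrow b u ∧ G.Arrow b v)) ∧ ∃ k ∈ Z, b = some k) ∨
        ((G.Arrow u b ∧ G.Arrow v b) ∧ ∀ k ∈ Z, ¬ G.IsDescendant b (some k))) := by
  have h1 := G.arrow_asymm u b
  have h2 := G.arrow_asymm b u
  have h3 := G.arrow_asymm v b
  have h4 := G.arrow_asymm b v
  have hd : (∃ z ∈ some '' (Z : Set (Fin M)), Relation.ReflTransGen G.Arrow b z) ↔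
      ¬ ∀ k ∈ Z, ¬ G.IsDescendant b (some k) := by
    simp [IsDescendant]
  have hz : b ∈ some '' (Z : Set (Fin M)) ↔ ∃ k ∈ Z, b = some k := by
    simp [eq_comm]
  unfold WeaklyActive
  rw [hd, hz]
  clear hd hz
  generalize (∀ k ∈ Z, ¬ G.IsDescendant b (some k)) = D
  generalize (∃ k ∈ Z, b = some k) = B
  rcases hu with hu | hu <;> rcases hv with hv | hv <;> simp_all

/-- An active trail without repetitions is an unblocked path (`exists_injOn_isTrail`), and an
unblocked path is a weakly active trail, to which `IsTrail.reach` applies. -/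
theorem dSeparates_iff_not_reach {Z A : Finset (Fin M)} (hZA : Disjoint Z A) :
    G.DSeparates Z A ↔
      ∀ d, ¬ Reach G.Arrow (some '' (Z : Set (Fin M))) (some '' (A : Set (Fin M))) d none := by
  constructor
  · intro hsep d hr
    obtain ⟨w, n, hw, ⟨a, ha, ha'⟩, hy, hinj⟩ := exists_injOn_isTrail G.arrow_asymm hr
    have key : ∀ m ≤ n, ∃ p : G.skeleton.Walk (w 0) (w m),
        p.support = (List.range (m + 1)).map w := by
      intro m
      induction m with
      | zero => exact fun _ => ⟨.nil, by simp⟩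
      | succ m ih =>
        intro hm
        obtain ⟨p, hp⟩ := ih (by omega)
        refine ⟨p.concat (G.skeleton_adj.2 (hw.1 m (by omega))), ?_⟩
        rw [SimpleGraph.Walk.support_concat, hp, List.range_succ (n := m + 1)]
        simp
    obtain ⟨p, hp⟩ := key n le_rfl
    have hpath : p.IsPath := by
      rw [SimpleGraph.Walk.isPath_def, hp]
      refine List.Nodup.map_on ?_ List.nodup_range
      intro x hx y hy h
      exact hinj (by simpa [Nat.lt_succ_iff] using hx) (by simpa [Nat.lt_succ_iff] using hy) h
    have hb : G.Blocked Z p.support := by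
      have := hsep a ha (p.copy ha'.symm hy) (by simpa using hpath)
      simpa using this
    obtain ⟨u, b, v, hin, hblock⟩ := hb
    rw [hp] at hin
    obtain ⟨s, t, hst⟩ := hin
    have hlen := congrArg List.length hst
    simp only [List.length_append, List.length_cons, List.length_nil, List.length_map,
      List.length_range] at hlen
    have hget : ∀ k : ℕ, (s ++ [u, b, v] ++ t)[k]? = ((List.range (n + 1)).map w)[k]? := by
      intro k; rw [hst]
    have e0 := hget s.length
    have e1 := hget (s.length + 1)
    have e2 := hget (s.length + 2)
    rw [List.getElem?_map, List.getElem?_range (by omega)] at e0 e1 e2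
    simp at e0 e1 e2
    subst e0 e1 e2
    exact (G.weaklyActive_iff Z (hw.1 _ (by omega)) (hw.1 (s.length + 1) (by omega))).1
      (hw.2 _ (by omega)) hblock
  · intro hr i hi π hπ
    by_contra hb
    have ht : IsTrail G.Arrow (WeaklyActive G.Arrow (some '' (Z : Set (Fin M)))) π.getVert
        π.length := by
      have hadj : ∀ k < π.length, G.Arrow (π.getVert k) (π.getVert (k + 1)) ∨
          G.Arrow (π.getVert (k + 1)) (π.getVert k) := fun k hk =>
        G.skeleton_adj.1 (π.adj_getVert_succ hk)
      refine ⟨hadj, fun k hk => ?_⟩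
      rw [G.weaklyActive_iff Z (hadj k (by omega)) (hadj (k + 1) (by omega))]
      intro h
      refine hb ⟨_, _, _, ?_, h⟩
      rw [π.getVert_eq_support_getElem (by omega), π.getVert_eq_support_getElem (by omega),
        π.getVert_eq_support_getElem (by omega)]
      refine ⟨π.support.take k, π.support.drop (k + 3), ?_⟩
      have hl : k + 2 < π.support.length := by rw [π.length_support]; omega
      conv_rhs => rw [← List.take_append_drop k π.support]
      rw [List.drop_eq_getElem_cons (by omega : k < π.support.length),
        List.drop_eq_getElem_cons (by omega : k + 1 < π.support.length),
        List.drop_eq_getElem_cons hl]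
      simp
    obtain ⟨d, hd⟩ := ht.reach G.arrow_asymm (A := some '' (A : Set (Fin M)))
      (by
        rw [Set.disjoint_image_iff (Option.some_injective _)]
        exact_mod_cast hZA)
      (by simpa using hi)
    rw [π.getVert_length] at hd
    exact hr d hd

end CausalBanditGraph

/-! ### Sums over products of kernels -/

section Sums

set_option linter.unusedSectionVars false

/-- This is the device for summing out one node: split off the coordinate `m` and compare the inner
sums. -/
theorem sum_eq_sum_of_update {ι : Type*} [Fintype ι] [DecidableEq ι] {X : ι → Type*}
    [∀ i, Fintype (X i)] {β : Type*} [AddCommMonoid β] (m : ι) (f g : (∀ i, X i) → β)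
    (h : ∀ x, ∑ t, f (Function.update x m t) = ∑ t, g (Function.update x m t)) :
    ∑ x, f x = ∑ x, g x := by
  have key : ∀ f : (∀ i, X i) → β, ∑ x, f x =
      ∑ r : ∀ j : {j // j ≠ m}, X j, ∑ t, f ((Equiv.piSplitAt m X).symm (t, r)) := by
    intro f
    rw [← (Equiv.piSplitAt m X).symm.sum_comp, Fintype.sum_prod_type_right]
  rw [key f, key g]
  refine Finset.sum_congr rfl fun r _ => ?_
  rcases isEmpty_or_nonempty (X m) with hm | ⟨⟨t₀⟩⟩
  · simp
  · have hu : ∀ t, Function.update ((Equiv.piSplitAt m X).symm (t₀, r)) m t =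
        (Equiv.piSplitAt m X).symm (t, r) := by
      intro t
      rw [Equiv.eq_symm_apply]
      ext j
      · simp
      · simp [j.2]
    simpa only [hu] using h ((Equiv.piSplitAt m X).symm (t₀, r))

theorem _root_.DependsOn.update_eq {ι β : Type*} [DecidableEq ι] {X : ι → Type*} {f : (∀ i, X i) → β}
    {s : Set ι} (hf : DependsOn f s) {m : ι} (hm : m ∉ s) (x : ∀ i, X i) (t : X m) :
    f (Function.update x m t) = f x :=
  hf fun i hi => Function.update_of_ne (fun h => hm (by rwa [← h])) _ _

theorem _root_.DependsOn.comp₂ {ι β γ δ : Type*} {X : ι → Type*} {f : (∀ i, X i) → β}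
    {g : (∀ i, X i) → γ} {s : Set ι} (hf : DependsOn f s) (hg : DependsOn g s) (F : β → γ → δ) :
    DependsOn (fun x => F (f x) (g x)) s :=
  fun x y h => by simp only [hf h, hg h]

theorem dependsOn_prod {ι κ S : Type*} [CommMonoid S] {X : ι → Type*} {f : κ → (∀ i, X i) → S}
    {s : Set ι} {D : Finset κ} (hf : ∀ i ∈ D, DependsOn (f i) s) :
    DependsOn (fun x => ∏ i ∈ D, f i x) s :=
  fun _ _ h => Finset.prod_congr rfl fun i hi => hf i hi h

variable {M : ℕ} {X : Fin M → Type*} [∀ i, Fintype (X i)]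

/-- Kernels of nodes on which nothing else depends may be replaced in a sum. -/
theorem sum_mul_prod_kernel {S : Type*} [CommSemiring S] (k : ∀ _ : Fin M, (∀ j, X j) → S)
    (u : ∀ i, X i → S) (hk : ∀ i, DependsOn (k i) (Set.Iic i))
    (hsum : ∀ i x, ∑ t, k i (Function.update x i t) = ∑ t, u i t) (D : Finset (Fin M))
    (f : (∀ j, X j) → S) (hf : DependsOn f (D : Set (Fin M))ᶜ) :
    ∑ x, f x * ∏ i ∈ D, k i x = ∑ x, f x * ∏ i ∈ D, u i (x i) := by
  induction D using Finset.induction_on_max generalizing f with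
  | empty => simp
  | insert m D hD ih =>
    have hm : m ∉ D := fun h => (hD m h).false
    -- The largest node of the set is summed out first, since neither `f` nor the other kernels
    -- depend on it. The factor `u m` keeps all sums over the same index type and is absorbed into
    -- `f`.
    have h1 : ∑ x, f x * ∏ i ∈ insert m D, k i x =
        ∑ x, (f x * u m (x m)) * ∏ i ∈ D, k i x := by
      apply sum_eq_sum_of_update m
      intro x
      have e1 : ∀ t, f (Function.update x m t) = f x :=
        fun t => hf.update_eq (by simp) x t
      have e2 : ∀ t, ∏ i ∈ D, k i (Function.update x m t) = ∏ i ∈ D, k i x := fun t =>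
        Finset.prod_congr rfl fun i hi => (hk i).update_eq (by simpa using hD i hi) x t
      simp only [Finset.prod_insert hm, e1, e2, Function.update_self]
      have e3 : ∀ t, f x * (k m (Function.update x m t) * ∏ i ∈ D, k i x) =
          (f x * ∏ i ∈ D, k i x) * k m (Function.update x m t) := fun t => by ring
      have e4 : ∀ t, f x * u m t * ∏ i ∈ D, k i x = (f x * ∏ i ∈ D, k i x) * u m t :=
        fun t => by ring
      simp only [e3, e4, ← Finset.mul_sum, hsum]
    rw [h1, ih]
    · refine Finset.sum_congr rfl fun x _ => ?_
      rw [Finset.prod_insert hm, mul_assoc]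
    · intro x y h
      have : f x = f y := hf fun i hi => h i fun h' => hi (by simp at h' ⊢; exact .inr h')
      simp only [this, h m (by simpa using hm)]

theorem sum_prod_kernel_eq_one {S : Type*} [CommSemiring S] (k : ∀ _ : Fin M, (∀ j, X j) → S)
    (u : ∀ i, X i → S) (hk : ∀ i, DependsOn (k i) (Set.Iic i))
    (hsum : ∀ i x, ∑ t, k i (Function.update x i t) = ∑ t, u i t) (hu : ∀ i, ∑ t, u i t = 1) :
    ∑ x, ∏ i, k i x = 1 := by
  have := sum_mul_prod_kernel k u hk hsum Finset.univ (fun _ => 1) (fun _ _ _ => rfl)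
  simp only [one_mul] at this
  rw [this, ← Fintype.prod_sum]
  simp [hu]

open Classical in
/-- The kernels after an intervention that sets the nodes in `A` to `α`. -/
noncomputable def setKernel {S : Type*} [Zero S] [One S] (A : Finset (Fin M)) (α : ∀ i, X i)
    (K : ∀ _ : Fin M, (∀ j, X j) → S) (i : Fin M) (x : ∀ j, X j) : S :=
  if i ∈ A then (if x i = α i then 1 else 0) else K i x

theorem setKernel_dependsOn {S : Type*} [Zero S] [One S] {A : Finset (Fin M)} {α : ∀ i, X i}
    {K : ∀ _ : Fin M, (∀ j, X j) → S} {i : Fin M} {s : Set (Fin M)} (hs : i ∈ s)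
    (hK : i ∉ A → DependsOn (K i) s) : DependsOn (setKernel A α K i) s := by
  intro x y h
  unfold setKernel
  split_ifs with h1 h2 h3 h3
  · rfl
  · exact absurd (h i hs ▸ h2) h3
  · exact absurd (h i hs ▸ h3) h2
  · rfl
  · exact hK h1 h

theorem sum_setKernel {S : Type*} [NonAssocSemiring S] {A : Finset (Fin M)} {α : ∀ i, X i}
    {K : ∀ _ : Fin M, (∀ j, X j) → S}
    (hK : ∀ i x, ∑ t, K i (Function.update x i t) = 1) (i : Fin M) (x : ∀ j, X j) :
    ∑ t, setKernel A α K i (Function.update x i t) = 1 := by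
  classical
  unfold setKernel
  split_ifs
  · simp
  · exact hK i x

/-! ### The exchange argument -/

variable {G : CausalBanditGraph M} {Z A : Finset (Fin M)}

/-- Child steps along the directed path from `v` would reach `y` unless some node of it lies in `Z`.
-/
theorem Reach.exists_descendant {V : Type*} {R : V → V → Prop} {Z A : Set V} {d : Bool} {v y : V}
    (h : Reach R Z A d v) (hy : ∀ d, ¬ Reach R Z A d y) (hd : Relation.ReflTransGen R v y) :
    ∃ z ∈ Z, Relation.ReflTransGen R v z := by
  induction hd using Relation.ReflTransGen.head_induction_on generalizing d with
  | refl => exact absurd h (hy d)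
  | @head b c hab _ ih =>
    by_cases hb : b ∈ Z
    · exact ⟨b, hb, .refl⟩
    · obtain ⟨z, hz, hd⟩ := ih (.child h hb hab)
      exact ⟨z, hz, hd.head hab⟩

/-- If `y` cannot be reached, then the family of an ancestor of `Z` or `y` is, up to nodes in `Z`,
either reached completely or not at all. -/
theorem reach_family {V : Type*} {R : V → V → Prop} {Z A : Set V} {y v : V}
    (hy : ∀ d, ¬ Reach R Z A d y)
    (hv : (∃ z ∈ Z, Relation.ReflTransGen R v z) ∨ Relation.ReflTransGen R v y) {u u' : V}
    (hu : u = v ∨ R u v) (hu' : u' = v ∨ R u' v) (huZ : u ∉ Z)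
    (h : ∃ d, Reach R Z A d u) : ∃ d, Reach R Z A d u' := by
  obtain ⟨d, h⟩ := h
  have hpar : ∀ d, Reach R Z A d v → (d = true ∨ v ∉ Z) → R u' v → ∃ d, Reach R Z A d u' := by
    intro d h hd hr
    cases d with
    | false => exact ⟨_, .parent h (by simpa using hd) hr⟩
    | true =>
      obtain ⟨z, hz, hvz⟩ := hv.elim id (h.exists_descendant hy)
      exact ⟨_, h.parent_of_descendant hz hvz hr⟩
  have hv' : ∃ d, Reach R Z A d v ∧ (d = true ∨ v ∉ Z) := by
    rcases hu with rfl | hu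
    · exact ⟨d, h, .inr huZ⟩
    · exact ⟨_, .child h huZ hu, .inl rfl⟩
  obtain ⟨d, h, hd⟩ := hv'
  rcases hu' with rfl | hu'
  · exact ⟨d, h⟩
  · exact hpar d h hd hu'

open Classical in
/-- The indicator of the outcomes with context `z`. -/
noncomputable def contextIndicator {S : Type*} [Zero S] [One S] (z : ∀ i : Z, X i)
    (x : ∀ j, X j) : S :=
  if Z.restrict x = z then 1 else 0

open Classical in
/-- Exchanging the reached coordinates of two outcomes shows that the ratio of the masses does not
depend on the intervention. -/
theorem sum_setKernel_mul_comm {S : Type*} [CommSemiring S] (hZA : Disjoint Z A)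
    (hY : ∀ d, ¬ Reach (G.mutilate A).Arrow (some '' (Z : Set (Fin M)))
      (some '' (A : Set (Fin M))) d none)
    (K : ∀ _ : Fin M, (∀ j, X j) → S)
    (hK : ∀ i, DependsOn (K i) (insert i (G.parents (some i) : Set (Fin M))))
    (hsum : ∀ i x, ∑ t, K i (Function.update x i t) = 1)
    (u : ∀ i, X i → S) (hu : ∀ i, ∑ t, u i t = 1)
    (z : ∀ i : Z, X i) (f g : (∀ j, X j) → S)
    (hf : DependsOn f (G.parents none : Set (Fin M)))
    (hg : DependsOn g (G.parents none : Set (Fin M))) (α α' : ∀ i, X i) :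
    (∑ x, (∏ i, setKernel A α K i x) * (contextIndicator z x * f x)) *
        (∑ x, (∏ i, setKernel A α' K i x) * (contextIndicator z x * g x)) =
      (∑ x, (∏ i, setKernel A α' K i x) * (contextIndicator z x * f x)) *
        (∑ x, (∏ i, setKernel A α K i x) * (contextIndicator z x * g x)) := by
  set R := (G.mutilate A).Arrow with hR
  set Z' : Set (Option (Fin M)) := some '' (Z : Set (Fin M)) with hZ'
  set A' : Set (Option (Fin M)) := some '' (A : Set (Fin M)) with hA'
  let E : Fin M → Prop := fun i => (∃ z ∈ Z', Relation.ReflTransGen R (some i) z) ∨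
    Relation.ReflTransGen R (some i) none
  -- The nodes of `D` are neither intervened on nor ancestors of `Z` or `Y`. Their families may be
  -- partly reached, so their kernels are first replaced by weights `u` of one coordinate each.
  let D : Finset (Fin M) := Finset.univ.filter fun i => i ∉ A ∧ ¬ E i
  let K' : ∀ _ : Fin M, (∀ j, X j) → S := fun i x => if E i then K i x else u i (x i)
  have hfam : ∀ i, insert i (G.parents (some i) : Set (Fin M)) ⊆ Set.Iic i := by
    rintro i j (rfl | hj)
    · simp
    · simp only [CausalBanditGraph.parents, Finset.coe_filter, Set.mem_ofPred_eq] at hj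
      exact (G.lt_of_arrow _ _ hj.2).le
  have harr : ∀ i, i ∉ A → ∀ j ∈ G.parents (some i), R (some j) (some i) := by
    intro i hi j hj
    simp only [CausalBanditGraph.parents, Finset.mem_filter] at hj
    exact ⟨hj.2, fun l hl h => hi (by simp at h; exact h ▸ hl)⟩
  have harrY : ∀ j ∈ G.parents none, R (some j) none := by
    intro j hj
    simp only [CausalBanditGraph.parents, Finset.mem_filter] at hj
    exact ⟨hj.2, fun l hl h => by simp at h⟩
  have hEpar : ∀ i, i ∉ A → E i → ∀ j ∈ G.parents (some i), E j := by
    rintro i hi (⟨z, hz, hd⟩ | hd) j hj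
    · exact .inl ⟨z, hz, hd.head (harr i hi j hj)⟩
    · exact .inr (hd.head (harr i hi j hj))
  have hrep : ∀ (α : ∀ i, X i) (f : (∀ j, X j) → S),
      DependsOn f (G.parents none : Set (Fin M)) →
      ∑ x, (∏ i, setKernel A α K i x) * (contextIndicator z x * f x) =
      ∑ x, (∏ i, setKernel A α K' i x) * (contextIndicator z x * f x) := by
    intro α f hf
    have hdep : DependsOn (fun x => (∏ i ∈ Dᶜ, setKernel A α K i x) *
        (contextIndicator z x * f x)) ((D : Set (Fin M))ᶜ) := by
      have h1 : DependsOn (fun x => ∏ i ∈ Dᶜ, setKernel A α K i x) ((D : Set (Fin M))ᶜ) := by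
        refine dependsOn_prod fun i hi => setKernel_dependsOn (by simpa using hi) fun hiA => ?_
        refine (hK i).mono ?_
        have hEi : E i := by
          by_contra hE
          simp [D, hiA, hE] at hi
        rintro j (rfl | hj)
        · simpa using hi
        · have := hEpar i hiA hEi j hj
          simp [D, this]
      have h2 : DependsOn (contextIndicator (S := S) z)
          ((D : Set (Fin M))ᶜ) := by
        intro x y h
        have : Z.restrict x = Z.restrict y := by
          ext j
          refine h j ?_
          have : E j := .inl ⟨_, ⟨j.1, j.2, rfl⟩, .refl⟩
          simp [D, this]
        simp only [contextIndicator, this]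
      have h3 : DependsOn f ((D : Set (Fin M))ᶜ) := by
        refine hf.mono fun j hj => ?_
        have : E j := .inr (.single (harrY j hj))
        simp [D, this]
      exact h1.comp₂ (h2.comp₂ h3 (· * ·)) (· * ·)
    have := sum_mul_prod_kernel (setKernel A α K) u
      (fun i => setKernel_dependsOn (by simp) fun _ => (hK i).mono (hfam i))
      (fun i x => by rw [sum_setKernel hsum, hu]) D _ hdep
    calc _ = ∑ x, (∏ i ∈ Dᶜ, setKernel A α K i x) *
          (contextIndicator z x * f x) * ∏ i ∈ D, setKernel A α K i x := by
          refine Finset.sum_congr rfl fun x _ => ?_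
          rw [← Finset.prod_mul_prod_compl D]; ring
      _ = _ := this
      _ = _ := by
          refine Finset.sum_congr rfl fun x _ => ?_
          rw [← Finset.prod_mul_prod_compl D (fun i => setKernel A α K' i x)]
          have e1 : ∏ i ∈ D, setKernel A α K' i x = ∏ i ∈ D, u i (x i) := by
            refine Finset.prod_congr rfl fun i hi => ?_
            simp only [D, Finset.mem_filter] at hi
            simp [setKernel, K', hi.2]
          have e2 : ∏ i ∈ Dᶜ, setKernel A α K' i x = ∏ i ∈ Dᶜ, setKernel A α K i x := by
            refine Finset.prod_congr rfl fun i hi => ?_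
            by_cases hiA : i ∈ A
            · simp [setKernel, hiA]
            · have hEi : E i := by
                by_contra hE
                simp [D, hiA, hE] at hi
              simp [setKernel, K', hEi]
          rw [e1, e2]; ring
  rw [hrep α f hf, hrep α' g hg, hrep α' f hf, hrep α g hg, Finset.sum_mul_sum,
    Finset.sum_mul_sum, ← Fintype.sum_prod_type', ← Fintype.sum_prod_type']
  -- `σ` swaps the coordinates in `U`. Since `A` lies in `U`, it exchanges the point masses at `α`
  -- and `α'`.
  let U : Fin M → Prop := fun i => i ∉ Z ∧ ∃ d, Reach R Z' A' d (some i)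
  let σ : ((∀ j, X j) × (∀ j, X j)) → (∀ j, X j) × (∀ j, X j) := fun q =>
    (fun i => if U i then q.2 i else q.1 i, fun i => if U i then q.1 i else q.2 i)
  have hσ : Function.Involutive σ := by
    intro q
    ext i <;> simp only [σ] <;> split_ifs <;> rfl
  have hUA : ∀ i ∈ A, U i := fun i hi =>
    ⟨fun h => Finset.disjoint_left.1 hZA h hi, _, .start ⟨i, hi, rfl⟩⟩
  refine Fintype.sum_equiv hσ.toPerm _ _ ?_
  rintro ⟨x, x'⟩
  simp only [Function.Involutive.coe_toPerm]
  have hσZ : ∀ q, Z.restrict (σ q).1 = Z.restrict q.1 ∧ Z.restrict (σ q).2 = Z.restrict q.2 := by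
    intro q
    constructor <;> ext j <;> simp [σ, U]
  have hcσ : ∀ q, contextIndicator (S := S) z (σ q).1 = contextIndicator z q.1 ∧
      contextIndicator (S := S) z (σ q).2 = contextIndicator z q.2 := by
    intro q
    simp only [contextIndicator, hσZ, and_self]
  rw [(hcσ _).1, (hcσ _).2]
  by_cases hx : Z.restrict x = z
  swap
  · simp [contextIndicator, hx]
  by_cases hx' : Z.restrict x' = z
  swap
  · simp [contextIndicator, hx']
  have hxx : ∀ j ∈ Z, x j = x' j := fun j hj => congrFun (hx.trans hx'.symm) ⟨j, hj⟩
  have hsame : ∀ {β : Type _} (h : (∀ j, X j) → β) (s : Set (Fin M)), DependsOn h s →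
      (∀ j ∈ s, ¬ U j) → h (σ (x, x')).1 = h x ∧ h (σ (x, x')).2 = h x' := by
    intro β h s hs hU
    exact ⟨hs fun j hj => by simp [σ, hU j hj], hs fun j hj => by simp [σ, hU j hj]⟩
  have hYU : ∀ j ∈ (G.parents none : Set (Fin M)), ¬ U j := by
    rintro j hj ⟨hjZ, d, hd⟩
    exact hY true (.child hd (by simpa [hZ'] using hjZ) (harrY j hj))
  rw [(hsame f _ hf hYU).1, (hsame g _ hg hYU).2]
  have hprod : (∏ i, setKernel A α K' i x) * (∏ i, setKernel A α' K' i x') =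
      (∏ i, setKernel A α' K' i (σ (x, x')).1) * (∏ i, setKernel A α K' i (σ (x, x')).2) := by
    rw [← Finset.prod_mul_distrib, ← Finset.prod_mul_distrib]
    refine Finset.prod_congr rfl fun i _ => ?_
    by_cases hiA : i ∈ A
    · simp only [setKernel, hiA, if_true, σ, hUA i hiA]
      rw [mul_comm]
    simp only [setKernel, hiA, if_false, K']
    by_cases hE : E i
    · simp only [hE, if_true]
      by_cases hi : ∀ j ∈ insert i (G.parents (some i) : Set (Fin M)), ¬ U j
      · rw [(hsame _ _ (hK i) hi).1, (hsame _ _ (hK i) hi).2]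
      · push Not at hi
        obtain ⟨j₀, hj₀, hjZ, hU⟩ := hi
        have hR' : ∀ j ∈ insert i (G.parents (some i) : Set (Fin M)),
            (some j : Option (Fin M)) = some i ∨ R (some j) (some i) := by
          rintro j (rfl | hj)
          · exact .inl rfl
          · exact .inr (harr i hiA j hj)
        have hall : ∀ j ∈ insert i (G.parents (some i) : Set (Fin M)), j ∈ Z ∨ U j := by
          intro j hj
          by_cases hz : j ∈ Z
          · exact .inl hz
          · exact .inr ⟨hz, reach_family hY hE (hR' _ hj₀) (hR' _ hj) (by simpa [hZ'] using hjZ)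
              hU⟩
        have e1 : K i (σ (x, x')).1 = K i x' := hK i fun j hj => by
          rcases hall j hj with h | h
          · simp [σ, hxx j h]
          · simp [σ, h]
        have e2 : K i (σ (x, x')).2 = K i x := hK i fun j hj => by
          rcases hall j hj with h | h
          · simp [σ, hxx j h]
          · simp [σ, h]
        rw [e1, e2, mul_comm]
    · simp only [hE, if_false, σ]
      split_ifs
      · rw [mul_comm]
      · rfl
  simp only [contextIndicator, hx, hx', if_true, one_mul]
  calc _ = ((∏ i, setKernel A α K' i x) * (∏ i, setKernel A α' K' i x')) * (f x * g x') := by ring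
    _ = _ := by rw [hprod]; ring

end Sums

/-! ### Interventional distributions of context and reward -/

section Interventional

set_option linter.unusedSectionVars false

theorem measure_ext_singleton_prod {𝒵 𝒴 : Type*} [MeasurableSpace 𝒵] [MeasurableSpace 𝒴]
    [Countable 𝒵] [MeasurableSingletonClass 𝒵] {μ ν : Measure (𝒵 × 𝒴)}
    (h : ∀ z B, MeasurableSet B → μ ({z} ×ˢ B) = ν ({z} ×ˢ B)) : μ = ν := by
  ext s hs
  have hdec : s = ⋃ z : 𝒵, {z} ×ˢ (Prod.mk z ⁻¹' s) := by
    ext ⟨z, y⟩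
    simp
  have hd : Pairwise (Function.onFun Disjoint fun z : 𝒵 => ({z} : Set 𝒵) ×ˢ (Prod.mk z ⁻¹' s)) := by
    intro z z' hz
    simp only [Function.onFun, Set.disjoint_prod, Set.disjoint_singleton]
    exact .inl hz
  have hm : ∀ z : 𝒵, MeasurableSet (Prod.mk z ⁻¹' s) := fun z => measurable_prodMk_left hs
  rw [hdec, measure_iUnion hd fun z => (measurableSet_singleton z).prod (hm z),
    measure_iUnion hd fun z => (measurableSet_singleton z).prod (hm z)]
  exact tsum_congr fun z => h z _ (hm z)

/-- With countably many contexts, disintegration can be checked on atoms, without division. -/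
theorem isCondKernel_iff {𝒵 𝒴 : Type*} [MeasurableSpace 𝒵] [MeasurableSpace 𝒴]
    [Countable 𝒵] [MeasurableSingletonClass 𝒵] (μ : Measure (𝒵 × 𝒴)) [IsFiniteMeasure μ]
    (κ : Kernel 𝒵 𝒴) [IsMarkovKernel κ] :
    μ.IsCondKernel κ ↔
      ∀ z B, MeasurableSet B → μ ({z} ×ˢ B) = μ ({z} ×ˢ Set.univ) * κ z B := by
  have hfst : ∀ z, μ.fst {z} = μ ({z} ×ˢ Set.univ) := by
    intro z
    rw [Measure.fst_apply (measurableSet_singleton z)]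
    congr 1
    ext ⟨z', y⟩
    simp
  have hcomp : ∀ z B, MeasurableSet B →
      (μ.fst ⊗ₘ κ) ({z} ×ˢ B) = μ ({z} ×ˢ Set.univ) * κ z B := by
    intro z B hB
    rw [Measure.compProd_apply_prod (measurableSet_singleton z) hB, lintegral_singleton, hfst,
      mul_comm]
  constructor
  · intro h z B hB
    rw [← hcomp z B hB, h.disintegrate]
  · intro h
    refine ⟨measure_ext_singleton_prod fun z B hB => ?_⟩
    rw [hcomp z B hB, h z B hB]

variable {M : ℕ} {X : Fin M → Type*} [∀ i, MeasurableSpace (X i)]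

/-- The conditional probability of the value of the `i`-th variable given its parents. -/
noncomputable def nodeKernel (G : CausalBanditGraph M) (p : Measure (Outcome X)) (i : Fin M)
    (x : ∀ j, X j) : ENNReal :=
  p[{ω | ω.1 i = x i} | agree (G.parents (some i)) x]

/-- The conditional distribution of the reward given its parents. -/
noncomputable def rewardKernel (G : CausalBanditGraph M) (p : Measure (Outcome X))
    (B : Set unitInterval) (x : ∀ j, X j) : ENNReal :=
  p[Prod.snd ⁻¹' B | agree (G.parents none) x]

theorem agree_congr {S : Finset (Fin M)} {x y : ∀ i, X i} (h : ∀ i ∈ S, x i = y i) :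
    agree S x = agree S y := by
  ext ω
  simp only [agree, Set.mem_ofPred_eq]
  exact forall₂_congr fun i hi => by rw [h i hi]

variable (G : CausalBanditGraph M) (p : Measure (Outcome X))

theorem nodeKernel_dependsOn (i : Fin M) :
    DependsOn (nodeKernel G p i) (insert i (G.parents (some i) : Set (Fin M))) := by
  intro x y h
  unfold nodeKernel
  rw [agree_congr fun j hj => h j (.inr hj), h i (.inl rfl)]

theorem rewardKernel_dependsOn (B : Set unitInterval) :
    DependsOn (rewardKernel G p B) (G.parents none : Set (Fin M)) := by
  intro x y h
  unfold rewardKernel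
  rw [agree_congr h]

variable [∀ i, Fintype (X i)]

open Classical in
-- Absorbing the indicator into point-mass kernels lets intervened nodes be treated like all others.
theorem weight_eq_prod_setKernel {A : Finset (Fin M)} {a : Intervention X} {α : ∀ i, X i}
    (ha : ∀ i, a i ≠ none ↔ i ∈ A) (hα : ∀ i ∈ A, a i = some (α i))
    (K : ∀ _ : Fin M, (∀ j, X j) → ENNReal) (x : ∀ i, X i) :
    (if ∀ i, a i ≠ none → a i = some (x i) then
        ∏ i ∈ Finset.univ.filter (fun i => a i = none), K i x else 0) =
      ∏ i, setKernel A α K i x := by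
  have hn : ∀ i, a i = none ↔ i ∉ A := fun i => by rw [← ha i, not_not]
  split_ifs with h
  · rw [Finset.prod_filter]
    refine Finset.prod_congr rfl fun i _ => ?_
    unfold setKernel
    by_cases hi : i ∈ A
    · have := h i ((ha i).2 hi)
      rw [hα i hi, Option.some_inj] at this
      simp [hi, hn, this]
    · simp [hi, hn]
  · push Not at h
    obtain ⟨i, hi, hx⟩ := h
    have hiA := (ha i).1 hi
    rw [hα i hiA, Ne, Option.some_inj] at hx
    exact (Finset.prod_eq_zero (Finset.mem_univ i) (by simp [setKernel, hiA, Ne.symm hx])).symm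

variable [∀ i, DiscreteMeasurableSpace (X i)]

theorem measurable_restrict_fst (Z : Finset (Fin M)) :
    Measurable fun ω : Outcome X => (Z.restrict ω.1, ω.2) :=
  ((Finset.measurable_restrict Z).comp measurable_fst).prodMk measurable_snd

open Classical in
theorem interventional_map_apply {A : Finset (Fin M)} {a : Intervention X} {α : ∀ i, X i}
    (ha : ∀ i, a i ≠ none ↔ i ∈ A) (hα : ∀ i ∈ A, a i = some (α i)) {Z : Finset (Fin M)}
    (z : ∀ i : Z, X i) {B : Set unitInterval} (hB : MeasurableSet B) :
    (interventional G p a).map (fun ω => (Z.restrict ω.1, ω.2)) ({z} ×ˢ B) =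
      ∑ x, (∏ i, setKernel A α (nodeKernel G p) i x) *
        (contextIndicator z x * rewardKernel G p B x) := by
  rw [Measure.map_apply (measurable_restrict_fst Z) ((measurableSet_singleton z).prod hB)]
  unfold interventional
  rw [Measure.finsetSum_apply]
  refine Finset.sum_congr rfl fun x _ => ?_
  have := weight_eq_prod_setKernel ha hα (nodeKernel G p) x
  unfold nodeKernel at this
  rw [Measure.smul_apply, this]
  have hpre : (fun ω : Outcome X => (Z.restrict ω.1, ω.2)) ⁻¹' ({z} ×ˢ B) =
      {x | Z.restrict x = z} ×ˢ B := by
    ext ω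
    simp
  rw [hpre, Measure.prod_prod, Measure.dirac_apply, Measure.map_apply measurable_snd hB]
  simp [contextIndicator, rewardKernel, Set.indicator_apply]
  rfl

variable {p}

theorem measurableSet_agree (S : Finset (Fin M)) (x : ∀ i, X i) :
    MeasurableSet (agree S x) :=
  measurable_fst (MeasurableSet.of_discrete (s := {y : ∀ i, X i | ∀ i ∈ S, y i = x i}))

theorem IsPositive.measure_agree_ne_zero (hp : IsPositive p) (S : Finset (Fin M))
    (x : ∀ i, X i) : p (agree S x) ≠ 0 := by
  refine ((hp.2 x).trans_le (measure_mono ?_)).ne'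
  rintro ω (rfl : ω.1 = x)
  exact fun _ _ => rfl

theorem IsPositive.isProbabilityMeasure_cond (hp : IsPositive p) (S : Finset (Fin M))
    (x : ∀ i, X i) : IsProbabilityMeasure p[|agree S x] :=
  have := hp.1
  cond_isProbabilityMeasure (hp.measure_agree_ne_zero S x)

theorem IsPositive.nodeKernel_ne_zero (hp : IsPositive p) (i : Fin M) (x : ∀ j, X j) :
    nodeKernel G p i x ≠ 0 := by
  have := hp.1
  unfold nodeKernel
  rw [cond_apply (measurableSet_agree _ _)]
  refine mul_ne_zero (ENNReal.inv_ne_zero.2 (measure_ne_top _ _)) ?_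
  refine ((hp.2 x).trans_le (measure_mono ?_)).ne'
  rintro ω (rfl : ω.1 = x)
  exact ⟨fun _ _ => rfl, rfl⟩

theorem IsPositive.sum_nodeKernel (hp : IsPositive p) (i : Fin M) (x : ∀ j, X j) :
    ∑ t, nodeKernel G p i (Function.update x i t) = 1 := by
  have := hp.isProbabilityMeasure_cond (G.parents (some i)) x
  have h1 : ∀ t, nodeKernel G p i (Function.update x i t) =
      (p[|agree (G.parents (some i)) x]).map (fun ω => ω.1 i) {t} := by
    intro t
    unfold nodeKernel
    rw [Measure.map_apply (by fun_prop) (measurableSet_singleton t),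
      agree_congr (y := x) fun j hj => Function.update_of_ne ?_ _ _]
    · simp; rfl
    · rintro rfl
      simp only [CausalBanditGraph.parents, Finset.mem_filter] at hj
      exact G.arrow_asymm _ _ hj.2 hj.2
  simp only [h1]
  have := Measure.isProbabilityMeasure_map (μ := p[|agree (G.parents (some i)) x])
    (f := fun ω => ω.1 i) (by fun_prop)
  rw [sum_measure_singleton, Finset.coe_univ, measure_univ]

theorem IsPositive.rewardKernel_univ (hp : IsPositive p) (x : ∀ j, X j) :
    rewardKernel G p Set.univ x = 1 := by
  have := hp.isProbabilityMeasure_cond (G.parents none) x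
  simp [rewardKernel]

variable [∀ i, Nonempty (X i)]

theorem IsPositive.isProbabilityMeasure_interventional (hp : IsPositive p)
    {A : Finset (Fin M)} {a : Intervention X} {α : ∀ i, X i}
    (ha : ∀ i, a i ≠ none ↔ i ∈ A) (hα : ∀ i ∈ A, a i = some (α i)) :
    IsProbabilityMeasure (interventional G p a) := by
  constructor
  -- With no context variables there is one context, whose mass is the total mass.
  let z₀ : ∀ i : (∅ : Finset (Fin M)), X i := fun _ => Classical.arbitrary _
  have h := interventional_map_apply G p ha hα z₀ .univ
  rw [Measure.map_apply (measurable_restrict_fst _) ((measurableSet_singleton _).prod .univ)] at h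
  have hpre : (fun ω : Outcome X => ((∅ : Finset (Fin M)).restrict ω.1, ω.2)) ⁻¹'
      ({z₀} ×ˢ Set.univ) = Set.univ := by
    ext ω
    simp [eq_iff_true_of_subsingleton]
  rw [hpre] at h
  rw [h]
  simp only [hp.rewardKernel_univ, contextIndicator, eq_iff_true_of_subsingleton, if_true, mul_one]
  refine sum_prod_kernel_eq_one _ (fun i _ => (Fintype.card (X i) : ENNReal)⁻¹)
    (fun i => setKernel_dependsOn (by simp) fun _ => (nodeKernel_dependsOn G p i).mono ?_)
    (fun i x => ?_) (fun i => ?_)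
  · rintro j (rfl | hj)
    · simp
    · simp only [CausalBanditGraph.parents, Finset.coe_filter, Set.mem_ofPred_eq] at hj
      exact (G.lt_of_arrow _ _ hj.2).le
  · rw [sum_setKernel (hp.sum_nodeKernel G)]
    simp [ENNReal.mul_inv_cancel]
  · simp [ENNReal.mul_inv_cancel]

theorem IsPositive.interventional_map_univ_ne_zero (hp : IsPositive p)
    {A : Finset (Fin M)} {a : Intervention X} {α : ∀ i, X i}
    (ha : ∀ i, a i ≠ none ↔ i ∈ A) (hα : ∀ i ∈ A, a i = some (α i)) {Z : Finset (Fin M)}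
    (hZA : Disjoint Z A) (z : ∀ i : Z, X i) :
    (interventional G p a).map (fun ω => (Z.restrict ω.1, ω.2)) ({z} ×ˢ Set.univ) ≠ 0 := by
  classical
  rw [interventional_map_apply G p ha hα z .univ]
  let x : ∀ i, X i := fun i => if h : i ∈ Z then z ⟨i, h⟩ else α i
  refine ((Finset.sum_pos_iff).2 ⟨x, Finset.mem_univ _, ?_⟩).ne'
  refine pos_iff_ne_zero.2 (mul_ne_zero (Finset.prod_ne_zero_iff.2 fun i _ => ?_) ?_)
  · unfold setKernel
    split_ifs with h1 h2
    · exact one_ne_zero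
    · have hi : i ∉ Z := fun h => Finset.disjoint_left.1 hZA h h1
      exact absurd (by simp [x, hi]) h2
    · exact hp.nodeKernel_ne_zero G i x
  · have : Z.restrict x = z := by
      ext i
      simp [x]
    simp [contextIndicator, this, hp.rewardKernel_univ]

/-- The distribution under any one action serves as `q`: it charges every context, and
`sum_setKernel_mul_comm` says that all actions share its conditional law of the reward. -/
theorem graphConditionallyBenign_of_dSeparates {Z A : Finset (Fin M)} (hZA : Disjoint Z A)
    (h : (G.mutilate A).DSeparates Z A) :
    GraphConditionallyBenign G Z (interventionsOn X A \ {nullIntervention X}) := by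
  classical
  intro p hp _
  have hmem : ∀ a : (interventionsOn X A \ {nullIntervention X} : Set (Intervention X)),
      ∀ i, a.1 i ≠ none ↔ i ∈ A := fun a => by
    rcases a.2.1 with h | h
    · exact h
    · exact absurd h a.2.2
  have hα : ∀ a : (interventionsOn X A \ {nullIntervention X} : Set (Intervention X)),
      ∃ α : ∀ i, X i, ∀ i ∈ A, a.1 i = some (α i) := by
    intro a
    refine ⟨fun i => (a.1 i).getD (Classical.arbitrary _), fun i hi => ?_⟩
    obtain ⟨v, hv⟩ := Option.ne_none_iff_exists'.1 ((hmem a i).2 hi)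
    simp [hv]
  rcases isEmpty_or_nonempty
    (interventionsOn X A \ {nullIntervention X} : Set (Intervention X)) with hemp | ⟨⟨a₀⟩⟩
  · exact ⟨.dirac (Classical.arbitrary _, 0), inferInstance, fun a => hemp.elim a⟩
  let μ : (interventionsOn X A \ {nullIntervention X} : Set (Intervention X)) →
      Measure ((∀ i : Z, X i) × unitInterval) :=
    fun a => (interventional G p a).map fun ω => (Z.restrict ω.1, ω.2)
  have hprob : ∀ a, IsProbabilityMeasure (μ a) := fun a => by
    obtain ⟨α, hα⟩ := hα a
    have := hp.isProbabilityMeasure_interventional G (hmem a) hα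
    exact Measure.isProbabilityMeasure_map (measurable_restrict_fst Z).aemeasurable
  have hne : ∀ a z, μ a ({z} ×ˢ Set.univ) ≠ 0 := fun a z => by
    obtain ⟨α, hα⟩ := hα a
    exact hp.interventional_map_univ_ne_zero G (hmem a) hα hZA z
  have hcomm : ∀ a a' z B, MeasurableSet B →
      μ a ({z} ×ˢ B) * μ a' ({z} ×ˢ Set.univ) = μ a' ({z} ×ˢ B) * μ a ({z} ×ˢ Set.univ) := by
    intro a a' z B hB
    obtain ⟨α, hα₁⟩ := hα a
    obtain ⟨α', hα₂⟩ := hα a'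
    simp only [μ]
    rw [interventional_map_apply G p (hmem a) hα₁ z hB,
      interventional_map_apply G p (hmem a') hα₂ z hB,
      interventional_map_apply G p (hmem a) hα₁ z .univ,
      interventional_map_apply G p (hmem a') hα₂ z .univ]
    exact sum_setKernel_mul_comm hZA
      (((G.mutilate A).dSeparates_iff_not_reach hZA).1 h) (nodeKernel G p)
      (nodeKernel_dependsOn G p) (hp.sum_nodeKernel G)
      (fun i _ => (Fintype.card (X i) : ENNReal)⁻¹) (fun i => by simp [ENNReal.mul_inv_cancel])
      z _ _ (rewardKernel_dependsOn G p B) (rewardKernel_dependsOn G p _) α α'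
  refine ⟨μ a₀, hprob a₀, fun a => ⟨?_, (μ a₀).condKernel, inferInstance, ?_, inferInstance⟩⟩
  · intro s hs
    have : s = ∅ := by
      by_contra hne'
      obtain ⟨z, hz⟩ := Set.nonempty_iff_ne_empty.2 hne'
      refine hne a₀ z (measure_mono_null ?_ (Measure.fst_apply (ρ := μ a₀) .of_discrete ▸ hs))
      rintro ⟨z', y⟩ ⟨rfl, -⟩
      exact hz
    simp [this]
  · have h0 : (μ a₀).IsCondKernel (μ a₀).condKernel := inferInstance
    change (μ a).IsCondKernel _
    rw [isCondKernel_iff] at h0 ⊢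
    intro z B hB
    have h1 := hcomm a a₀ z B hB
    rw [h0 z B hB, mul_assoc, mul_comm] at h1
    rw [(ENNReal.mul_right_inj (hne a₀ z) (measure_ne_top _ _)).1 h1, mul_comm]

end Interventional

/-! ### Markovian parents of positive distributions -/

section Markov

set_option linter.unusedSectionVars false

/-- Pass from `x` to `y` through the hybrid equal to `x` on `s` and to `y` elsewhere. All
combinations of values are available, which is the source of the intersection property of
conditional independence for positive distributions. -/
theorem dependsOn_inter {ι β : Type*} {X : ι → Type*} {f : (∀ i, X i) → β} {s t : Set ι}
    (hs : DependsOn f s) (ht : DependsOn f t) : DependsOn f (s ∩ t) := by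
  classical
  intro x y h
  refine (hs (y := s.piecewise x y) fun i hi => ?_).trans (ht fun i hi => ?_)
  · simp [hi]
  · by_cases his : i ∈ s
    · simp [his, h i ⟨his, hi⟩]
    · simp [his]

variable {M : ℕ} {X : Fin M → Type*} [∀ i, MeasurableSpace (X i)] [∀ i, Fintype (X i)]
  [∀ i, DiscreteMeasurableSpace (X i)] {p : Measure (Outcome X)}
  {β : Type*} [MeasurableSpace β] {f : Outcome X → β}

/-- Positivity makes conditioning on every value of `pre` meaningful, so conditional independence
becomes a statement about which coordinates a function depends on. -/
theorem condIndepGiven_iff (hp : IsPositive p) {pre S : Finset (Fin M)}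
    (hS : S ⊆ pre) :
    CondIndepGiven p f (pre \ S) S ↔
      ∀ B, MeasurableSet B → DependsOn (fun x => p[f ⁻¹' B | agree pre x]) (S : Set (Fin M)) := by
  classical
  have := hp.1
  have hr : Measurable fun ω : Outcome X => (pre \ S).restrict ω.1 :=
    (Finset.measurable_restrict _).comp measurable_fst
  have hinter : ∀ x : ∀ i, X i, agree S x ∩
      (fun ω : Outcome X => (pre \ S).restrict ω.1) ⁻¹' {(pre \ S).restrict x} = agree pre x := by
    intro x
    ext ω
    simp only [agree, Set.mem_inter_iff, Set.mem_ofPred_eq, Set.mem_preimage,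
      Set.mem_singleton_iff, funext_iff, Finset.restrict, Subtype.forall, Finset.mem_sdiff]
    constructor
    · rintro ⟨h1, h2⟩ i hi
      by_cases his : i ∈ S
      · exact h1 i his
      · exact h2 i ⟨hi, his⟩
    · exact fun h => ⟨fun i hi => h i (hS hi), fun i hi => h i hi.1⟩
  constructor
  · intro h B hB
    have key : ∀ x, p[f ⁻¹' B | agree pre x] = p[f ⁻¹' B | agree S x] := by
      intro x
      have := hp.isProbabilityMeasure_cond S x
      have hC := measurableSet_singleton ((pre \ S).restrict x)
      have hi := (h x).measure_inter_preimage_eq_mul B _ hB hC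
      rw [← hinter x, ← cond_cond_eq_cond_inter (measurableSet_agree S x) (hr hC),
        cond_apply (hr hC), Set.inter_comm, hi, mul_comm, mul_assoc, ENNReal.mul_inv_cancel,
        mul_one]
      · rw [cond_apply (measurableSet_agree S x), hinter x]
        exact mul_ne_zero (ENNReal.inv_ne_zero.2 (measure_ne_top _ _))
          (hp.measure_agree_ne_zero _ _)
      · exact measure_ne_top _ _
    intro x y hxy
    simp only [key]
    rw [agree_congr hxy]
  · intro h x
    have := hp.isProbabilityMeasure_cond S x
    -- The factor of proportionality does not depend on the value of `pre \ S`; comparing total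
    -- masses identifies it as the probability of `B` given `S`.
    have key : ∀ B, MeasurableSet B →
        ((p[|agree S x]).restrict (f ⁻¹' B)).map (fun ω => (pre \ S).restrict ω.1) =
          p[f ⁻¹' B | agree pre x] •
            (p[|agree S x]).map (fun ω => (pre \ S).restrict ω.1) := by
      intro B hB
      refine Measure.ext_of_singleton fun v => ?_
      let y : ∀ i, X i := fun i => if hi : i ∈ pre \ S then v ⟨i, hi⟩ else x i
      have hyS : ∀ i ∈ S, y i = x i := fun i hi => by simp [y, hi]
      have hyv : (pre \ S).restrict y = v := by
        ext i
        have := i.2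
        simp only [Finset.restrict, y]
        rw [dif_pos this]
      have hv := measurableSet_singleton v
      have hc : p[f ⁻¹' B | agree pre x] = p[f ⁻¹' B | agree pre y] :=
        h B hB fun i hi => (hyS i hi).symm
      rw [Measure.map_apply hr hv, Measure.restrict_apply (hr hv), Measure.smul_apply,
        Measure.map_apply hr hv, cond_apply (measurableSet_agree S x),
        cond_apply (measurableSet_agree S x), ← Set.inter_assoc, ← hyv, ← agree_congr hyS,
        hinter y, hc]
      simp only [smul_eq_mul]
      rw [cond_apply (measurableSet_agree pre y), mul_left_comm, mul_right_comm,
        ENNReal.inv_mul_cancel (hp.measure_agree_ne_zero _ _) (measure_ne_top _ _), one_mul]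
    rw [indepFun_iff_measure_inter_preimage_eq_mul]
    intro B C hB hC
    have h1 := congrArg (fun μ => μ C) (key B hB)
    have h2 := congrArg (fun μ => μ Set.univ) (key B hB)
    simp only [Measure.smul_apply, smul_eq_mul] at h1 h2
    rw [Measure.map_apply hr .univ, Measure.map_apply hr .univ, Set.preimage_univ,
      Measure.restrict_apply_univ, measure_univ, mul_one] at h2
    rw [Measure.map_apply hr hC, Measure.restrict_apply (hr hC), Measure.map_apply hr hC,
      ← h2] at h1
    rw [Set.inter_comm, h1]

theorem exists_isMarkovianParents (hp : IsPositive p) {pre T : Finset (Fin M)} (hT : T ⊆ pre)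
    (h : ∀ B, MeasurableSet B →
      DependsOn (fun x => p[f ⁻¹' B | agree pre x]) (T : Set (Fin M))) :
    ∃ S, IsMarkovianParents p f pre S ∧ S ⊆ T := by
  classical
  have hCI := (condIndepGiven_iff hp hT).2 h
  obtain ⟨S, hS, hmin⟩ := Finset.exists_min_image
    (pre.powerset.filter fun S => CondIndepGiven p f (pre \ S) S) Finset.card
    ⟨T, by simp [hT, hCI]⟩
  simp only [Finset.mem_filter, Finset.mem_powerset] at hS hmin
  refine ⟨S, ⟨hS.1, hS.2, fun T hT hC => hmin T ⟨hT, hC⟩⟩, ?_⟩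
  -- The intersection with `T` is again admissible, so minimality of `S` forces `S ⊆ T`.
  have hcard := hmin (S ∩ T) ⟨Finset.inter_subset_left.trans hS.1,
    (condIndepGiven_iff hp (Finset.inter_subset_left.trans hS.1)).2 fun B hB => by
      rw [Finset.coe_inter]
      exact dependsOn_inter ((condIndepGiven_iff hp hS.1).1 hS.2 B hB) (h B hB)⟩
  exact Finset.inter_eq_left.1 (Finset.eq_of_subset_of_card_le Finset.inter_subset_left hcard)

/-! ### Distributions given by kernels -/

/-- The distribution of the variables with kernels `k` and reward `g`. -/
noncomputable def modelMeasure (k : ∀ _ : Fin M, (∀ j, X j) → ENNReal)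
    (g : (∀ j, X j) → unitInterval) : Measure (Outcome X) :=
  ∑ x, (∏ i, k i x) • Measure.dirac (x, g x)

open Classical in
-- This computes the mass of `y i = t` together with an event about earlier nodes. Later kernels sum
-- to one, and `hc` says that the kernel at `t` is the constant `c` wherever `f` matters.
theorem sum_ite_mul_prod_kernel {S : Type*} [CommSemiring S]
    (k : ∀ _ : Fin M, (∀ j, X j) → S) (hk : ∀ i, DependsOn (k i) (Set.Iic i))
    (hsum : ∀ i x, ∑ t, k i (Function.update x i t) = 1) (u : ∀ i, X i → S)
    (hu : ∀ i, ∑ t, u i t = 1) (i : Fin M) (t : X i) (f : (∀ j, X j) → S)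
    (hf : DependsOn f (Set.Iio i)) (c : S)
    (hc : ∀ y, f y * k i (Function.update y i t) = f y * c) :
    ∑ y, (f y * if y i = t then 1 else 0) * ∏ j, k j y = c * ∑ y, f y * ∏ j, k j y := by
  have hsplit : ∀ y, ∏ j, k j y =
      (∏ j ∈ Finset.Iio i, k j y) * k i y * ∏ j ∈ Finset.Ioi i, k j y := by
    intro y
    have h1 : (Finset.univ : Finset (Fin M)) = Finset.Iic i ∪ Finset.Ioi i := by
      ext j; simp [le_or_gt]
    have h2 : Disjoint (Finset.Iic i) (Finset.Ioi i) :=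
      Finset.disjoint_left.2 fun j hj hj' => by
        simp at hj hj'; exact absurd hj hj'.not_ge
    rw [h1, Finset.prod_union h2, ← Finset.Iio_insert, Finset.prod_insert (by simp),
      mul_comm (k i y)]
  have hIio : DependsOn (fun y => ∏ j ∈ Finset.Iio i, k j y) (Set.Iio i) :=
    dependsOn_prod fun j hj => (hk j).mono (Set.Iic_subset_Iio.2 (by simpa using hj))
  have hcompl : (Finset.Ioi i : Set (Fin M))ᶜ = Set.Iic i := by ext; simp
  have hle : Set.Iio i ⊆ (Finset.Ioi i : Set (Fin M))ᶜ := by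
    rw [hcompl]; exact Set.Iio_subset_Iic_self
  have hout : ∀ h : (∀ j, X j) → S, DependsOn h (Set.Iic i) →
      ∑ y, h y * ∏ j, k j y =
        ∑ y, h y * ((∏ j ∈ Finset.Iio i, k j y) * k i y) * ∏ j ∈ Finset.Ioi i, u j (y j) := by
    intro h hh
    rw [← sum_mul_prod_kernel k u hk (fun j x => by rw [hsum, hu])]
    · exact Finset.sum_congr rfl fun y _ => by rw [hsplit]; ring
    · rw [hcompl]
      exact hh.comp₂ ((hIio.mono Set.Iio_subset_Iic_self).comp₂ (hk i) (· * ·)) (· * ·)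
  have hf' := hf.mono Set.Iio_subset_Iic_self
  rw [hout _ hf', hout (fun y => f y * if y i = t then 1 else 0), Finset.mul_sum]
  · apply sum_eq_sum_of_update i
    intro x
    have e1 : ∀ s, f (Function.update x i s) = f x := fun s => hf.update_eq (by simp) x s
    have e2 : ∀ s, ∏ j ∈ Finset.Iio i, k j (Function.update x i s) =
      ∏ j ∈ Finset.Iio i, k j x := fun s => hIio.update_eq (by simp) x s
    have e3 : ∀ s, ∏ j ∈ Finset.Ioi i, u j (Function.update x i s j) =
        ∏ j ∈ Finset.Ioi i, u j (x j) := fun s => Finset.prod_congr rfl fun j hj => by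
      rw [Function.update_of_ne (by rintro rfl; simp at hj)]
    simp only [e1, e2, e3, Function.update_self]
    have e4 : ∀ s, c * (f x * ((∏ j ∈ Finset.Iio i, k j x) * k i (Function.update x i s)) *
        ∏ j ∈ Finset.Ioi i, u j (x j)) = (f x * c) * ((∏ j ∈ Finset.Iio i, k j x) *
          ∏ j ∈ Finset.Ioi i, u j (x j)) * k i (Function.update x i s) := fun s => by ring
    have e5 : ∀ s, (f x * if s = t then 1 else 0) * ((∏ j ∈ Finset.Iio i, k j x) *
        k i (Function.update x i s)) * ∏ j ∈ Finset.Ioi i, u j (x j) =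
        if s = t then (f x * k i (Function.update x i s)) * ((∏ j ∈ Finset.Iio i, k j x) *
          ∏ j ∈ Finset.Ioi i, u j (x j)) else 0 := fun s => by
      split_ifs
      · ring
      · simp
    simp only [e4, e5, ← Finset.mul_sum, hsum, mul_one, Finset.sum_ite_eq', Finset.mem_univ,
      if_true, hc]
  · refine hf'.comp₂ (g := fun y => if y i = t then (1 : S) else 0) ?_ (· * ·)
    intro x y h
    simp only [h i (by simp : i ∈ Set.Iic i)]

variable {G : CausalBanditGraph M} {k : ∀ _ : Fin M, (∀ j, X j) → ENNReal}
  {g : (∀ j, X j) → unitInterval}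

theorem modelMeasure_apply {s : Set (Outcome X)} (hs : MeasurableSet s) :
    modelMeasure k g s = ∑ x, s.indicator 1 (x, g x) * ∏ i, k i x := by
  unfold modelMeasure
  rw [Measure.finsetSum_apply]
  refine Finset.sum_congr rfl fun x _ => ?_
  rw [Measure.smul_apply, Measure.dirac_apply' _ hs, smul_eq_mul, mul_comm]

theorem dependsOn_Iic_of_parents
    (hk : ∀ i, DependsOn (k i) (insert i (G.parents (some i) : Set (Fin M)))) (i : Fin M) :
    DependsOn (k i) (Set.Iic i) := by
  refine (hk i).mono ?_
  rintro j (rfl | hj)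
  · simp
  · simp only [CausalBanditGraph.parents, Finset.coe_filter, Set.mem_ofPred_eq] at hj
    exact (G.lt_of_arrow _ _ hj.2).le

theorem parents_subset_Iio (i : Fin M) : G.parents (some i) ⊆ Finset.Iio i := by
  intro j hj
  simp only [CausalBanditGraph.parents, Finset.mem_filter] at hj
  simpa using G.lt_of_arrow _ _ hj.2

variable [∀ i, Nonempty (X i)]
  (hk : ∀ i, DependsOn (k i) (insert i (G.parents (some i) : Set (Fin M))))
  (hsum : ∀ i x, ∑ t, k i (Function.update x i t) = 1)
  (hpos : ∀ i x, k i x ≠ 0) (hg : DependsOn g (G.parents none : Set (Fin M)))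

include hk hsum

theorem modelMeasure_isProbabilityMeasure : IsProbabilityMeasure (modelMeasure k g) := by
  constructor
  rw [modelMeasure_apply .univ]
  simp only [Set.indicator_univ, Pi.one_apply, one_mul]
  exact sum_prod_kernel_eq_one k (fun i _ => (Fintype.card (X i) : ENNReal)⁻¹)
    (dependsOn_Iic_of_parents hk) (fun i x => by rw [hsum]; simp [ENNReal.mul_inv_cancel])
    (fun i => by simp [ENNReal.mul_inv_cancel])

include hpos in
theorem modelMeasure_isPositive : IsPositive (modelMeasure k g) := by
  classical
  refine ⟨modelMeasure_isProbabilityMeasure hk hsum, fun x => ?_⟩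
  have hm : MeasurableSet {ω : Outcome X | ω.1 = x} :=
    measurable_fst (measurableSet_singleton x)
  rw [modelMeasure_apply hm]
  refine (Finset.sum_pos_iff).2 ⟨x, Finset.mem_univ _, pos_iff_ne_zero.2 (mul_ne_zero ?_ ?_)⟩
  · simp
  · exact Finset.prod_ne_zero_iff.2 fun i _ => hpos i x

include hpos in
-- Taking `S` to be the parents recovers the kernels; taking all predecessors gives the Markov
-- property.
theorem modelMeasure_cond_node {i : Fin M} {S : Finset (Fin M)} (hS : G.parents (some i) ⊆ S)
    (hS' : S ⊆ Finset.Iio i) (x : ∀ j, X j) (t : X i) :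
    (modelMeasure k g)[{ω | ω.1 i = t} | agree S x] = k i (Function.update x i t) := by
  classical
  have hp := modelMeasure_isPositive (g := g) hk hsum hpos
  have := hp.1
  have hm : MeasurableSet {ω : Outcome X | ω.1 i = t} :=
    (by fun_prop : Measurable fun ω : Outcome X => ω.1 i) (measurableSet_singleton t)
  rw [cond_apply (measurableSet_agree S x), modelMeasure_apply ((measurableSet_agree S x).inter hm)]
  have h := sum_ite_mul_prod_kernel k (dependsOn_Iic_of_parents hk) hsum
    (fun i _ => (Fintype.card (X i) : ENNReal)⁻¹) (fun i => by simp [ENNReal.mul_inv_cancel]) i t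
    (fun y => if ∀ j ∈ S, y j = x j then 1 else 0) ?_ (k i (Function.update x i t)) ?_
  · have e1 : ∀ y, (agree S x ∩ {ω | ω.1 i = t}).indicator (1 : Outcome X → ENNReal) (y, g y) =
        (if ∀ j ∈ S, y j = x j then 1 else 0) * if y i = t then 1 else 0 := by
      intro y
      simp only [Set.indicator_apply, Set.mem_inter_iff, agree, Set.mem_ofPred_eq, Pi.one_apply,
        ite_and]
      split_ifs <;> simp
    have e2 : modelMeasure k g (agree S x) =
        ∑ y, (if ∀ j ∈ S, y j = x j then 1 else 0) * ∏ j, k j y := by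
      rw [modelMeasure_apply (measurableSet_agree S x)]
      refine Finset.sum_congr rfl fun y _ => ?_
      simp only [Set.indicator_apply, agree, Set.mem_ofPred_eq, Pi.one_apply]
    simp only [e1]
    rw [h, ← e2, mul_left_comm,
      ENNReal.inv_mul_cancel (hp.measure_agree_ne_zero _ _) (measure_ne_top _ _), mul_one]
  · intro y z h
    have : (∀ j ∈ S, y j = x j) ↔ ∀ j ∈ S, z j = x j :=
      forall₂_congr fun j hj => by rw [h j (by simpa using hS' hj)]
    exact if_congr this rfl rfl
  · intro y
    by_cases hy : ∀ j ∈ S, y j = x j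
    · simp only [if_pos hy, one_mul]
      refine hk i fun j hj => ?_
      rcases eq_or_ne j i with rfl | hji
      · simp
      · rcases hj with hj | hj
        · exact absurd hj hji
        · simp [hji, hy j (hS hj)]
    · simp only [if_neg hy, zero_mul]

include hpos hg in
theorem modelMeasure_cond_reward {S : Finset (Fin M)} (hS : G.parents none ⊆ S) (x : ∀ j, X j)
    {B : Set unitInterval} (hB : MeasurableSet B) :
    (modelMeasure k g)[Prod.snd ⁻¹' B | agree S x] = B.indicator 1 (g x) := by
  classical
  have hp := modelMeasure_isPositive (g := g) hk hsum hpos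
  have := hp.1
  rw [cond_apply (measurableSet_agree S x),
    modelMeasure_apply ((measurableSet_agree S x).inter (measurable_snd hB))]
  have e1 : ∀ y, (agree S x ∩ Prod.snd ⁻¹' B).indicator (1 : Outcome X → ENNReal) (y, g y) =
      B.indicator 1 (g x) * (agree S x).indicator 1 (y, g y) := by
    intro y
    by_cases hy : (y, g y) ∈ agree S x
    · have : g y = g x := hg fun j hj => hy j (hS hj)
      rw [Set.indicator_of_mem hy]
      simp [Set.indicator_apply, this ▸ hy, this]
    · simp [hy]
  simp only [e1, mul_assoc]
  rw [← Finset.mul_sum, ← modelMeasure_apply (measurableSet_agree S x), mul_left_comm,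
    ENNReal.inv_mul_cancel (hp.measure_agree_ne_zero _ _) (measure_ne_top _ _), mul_one]

include hpos hg in
theorem modelMeasure_markovRelative : MarkovRelative (modelMeasure k g) G := by
  have hp := modelMeasure_isPositive (g := g) hk hsum hpos
  have := hp.1
  refine ⟨fun i => exists_isMarkovianParents hp (parents_subset_Iio i)
    fun B hB x y hxy => ?_, exists_isMarkovianParents hp (Finset.subset_univ _)
    fun B hB x y hxy => ?_⟩
  · have hm : Measurable fun ω : Outcome X => ω.1 i := by fun_prop
    have key : ((modelMeasure k g)[|agree (Finset.Iio i) x]).map (fun ω => ω.1 i) =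
        ((modelMeasure k g)[|agree (Finset.Iio i) y]).map (fun ω => ω.1 i) := by
      refine Measure.ext_of_singleton fun t => ?_
      rw [Measure.map_apply hm (measurableSet_singleton t),
        Measure.map_apply hm (measurableSet_singleton t)]
      have h1 := modelMeasure_cond_node (g := g) hk hsum hpos (parents_subset_Iio i)
        subset_rfl x t
      have h2 := modelMeasure_cond_node (g := g) hk hsum hpos (parents_subset_Iio i)
        subset_rfl y t
      refine h1.trans (Eq.trans ?_ h2.symm)
      refine hk i fun j hj => ?_
      rcases eq_or_ne j i with rfl | hji
      · simp
      · rcases hj with hj | hj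
        · exact absurd hj hji
        · simp [hji, hxy j hj]
    have := congrArg (fun μ => μ B) key
    simpa only [Measure.map_apply hm hB] using this
  · change (modelMeasure k g)[Prod.snd ⁻¹' B | _] = (modelMeasure k g)[Prod.snd ⁻¹' B | _]
    rw [modelMeasure_cond_reward hk hsum hpos hg (Finset.subset_univ _) x hB,
      modelMeasure_cond_reward hk hsum hpos hg (Finset.subset_univ _) y hB, hg hxy]

include hpos in
theorem nodeKernel_modelMeasure : nodeKernel G (modelMeasure k g) = k := by
  funext i x
  have := modelMeasure_cond_node (g := g) hk hsum hpos subset_rfl (parents_subset_Iio i) x (x i)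
  rwa [Function.update_eq_self] at this

end Markov

/-! ### Environments that are not conditionally benign -/

section NotBenign

set_option linter.unusedSectionVars false

open scoped NNReal

variable {M : ℕ} {X : Fin M → Type*} [∀ i, Fintype (X i)]

theorem coe_setKernel (A : Finset (Fin M)) (α : ∀ i, X i) (k : ∀ _ : Fin M, (∀ j, X j) → ℝ≥0)
    (i : Fin M) (x : ∀ j, X j) :
    setKernel A α (fun i x => (k i x : ENNReal)) i x = (setKernel A α k i x : ℝ≥0) := by
  unfold setKernel
  split_ifs <;> simp

/-- The mass of the context `z` and rewards in `B` after `A` has been set to `α`. -/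
noncomputable def mass {Z : Finset (Fin M)} (A : Finset (Fin M)) (z : ∀ i : Z, X i)
    (g : (∀ j, X j) → unitInterval) (k : ∀ _ : Fin M, (∀ j, X j) → ℝ≥0) (α : ∀ i, X i)
    (B : Set unitInterval) : ℝ≥0 :=
  ∑ x, (∏ i, setKernel A α k i x) * (contextIndicator z x * B.indicator 1 (g x))

variable [∀ i, MeasurableSpace (X i)] [∀ i, DiscreteMeasurableSpace (X i)]
  [∀ i, Nonempty (X i)] {G : CausalBanditGraph M} {Z A : Finset (Fin M)}

/-- Both actions share the conditional law under `q`, and absolute continuity makes the `q`-mass of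
`z` nonzero, so it can be cancelled from the cross products. -/
theorem GraphConditionallyBenign.mass_mul_mass_of_pos
    (h : GraphConditionallyBenign G Z (interventionsOn X A \ {nullIntervention X}))
    (hZA : Disjoint Z A) (hA : A.Nonempty) {k : ∀ _ : Fin M, (∀ j, X j) → ℝ≥0}
    {g : (∀ j, X j) → unitInterval}
    (hk : ∀ i, DependsOn (k i) (insert i (G.parents (some i) : Set (Fin M))))
    (hsum : ∀ i x, ∑ t, k i (Function.update x i t) = 1)
    (hpos : ∀ i x, k i x ≠ 0) (hg : DependsOn g (G.parents none : Set (Fin M)))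
    (z : ∀ i : Z, X i) (α α' : ∀ i, X i) {B : Set unitInterval} (hB : MeasurableSet B) :
    mass A z g k α B * mass A z g k α' Set.univ = mass A z g k α' B * mass A z g k α Set.univ := by
  classical
  let k' : ∀ _ : Fin M, (∀ j, X j) → ENNReal := fun i x => k i x
  have hk' : ∀ i, DependsOn (k' i) (insert i (G.parents (some i) : Set (Fin M))) :=
    fun i x y hxy => by simp only [k', hk i hxy]
  have hsum' : ∀ i x, ∑ t, k' i (Function.update x i t) = 1 := fun i x => by
    simp only [k']
    exact_mod_cast hsum i x
  have hpos' : ∀ i x, k' i x ≠ 0 := fun i x => by simpa [k'] using hpos i x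
  have hp := modelMeasure_isPositive (g := g) hk' hsum' hpos'
  obtain ⟨q, hq, hqa⟩ := h _ hp (modelMeasure_markovRelative hk' hsum' hpos' hg)
  let act : (∀ i, X i) → Intervention X := fun α i => if i ∈ A then some (α i) else none
  have hact : ∀ α i, act α i ≠ none ↔ i ∈ A := fun α i => by simp [act]
  have hact' : ∀ α, ∀ i ∈ A, act α i = some (α i) := fun α i hi => by simp [act, hi]
  have hmem : ∀ α, act α ∈ interventionsOn X A \ {nullIntervention X} := fun α => by
    refine ⟨.inl (hact α), fun hn => ?_⟩
    obtain ⟨i, hi⟩ := hA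
    exact (hact α i).2 hi (congrFun hn i)
  have hmass : ∀ α {B : Set unitInterval}, MeasurableSet B →
      (interventional G (modelMeasure k' g) (act α)).map (fun ω => (Z.restrict ω.1, ω.2))
        ({z} ×ˢ B) = (mass A z g k α B : ENNReal) := by
    intro α B hB
    rw [interventional_map_apply G _ (hact α) (hact' α) z hB,
      nodeKernel_modelMeasure (G := G) hk' hsum' hpos']
    unfold mass
    push_cast
    refine Finset.sum_congr rfl fun x _ => ?_
    rw [rewardKernel, modelMeasure_cond_reward hk' hsum' hpos' hg subset_rfl x hB]
    congr 1
    · exact Finset.prod_congr rfl fun i _ => coe_setKernel A α k i x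
    · congr 1
      unfold contextIndicator
      split_ifs <;> simp
  have key : ∀ α, (mass A z g k α B : ENNReal) * q ({z} ×ˢ Set.univ) =
      mass A z g k α Set.univ * q ({z} ×ˢ B) ∧ q ({z} ×ˢ Set.univ) ≠ 0 := by
    intro α
    obtain ⟨hac, κ, hκ, hκ₁, hκ₂⟩ := hqa ⟨act α, hmem α⟩
    simp only at hac hκ₁ hκ₂
    have := hp.isProbabilityMeasure_interventional G (hact α) (hact' α)
    have := Measure.isProbabilityMeasure_map
      (μ := interventional G (modelMeasure k' g) (act α)) (measurable_restrict_fst Z).aemeasurable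
    rw [isCondKernel_iff] at hκ₁ hκ₂
    have h1 := hκ₁ z B hB
    rw [hmass α hB, hmass α .univ] at h1
    refine ⟨by rw [h1, hκ₂ z B hB]; ring, fun h0 => ?_⟩
    refine hp.interventional_map_univ_ne_zero G (hact α) (hact' α) hZA z ?_
    have hfst : ∀ μ : Measure ((∀ i : Z, X i) × unitInterval),
        μ.fst {z} = μ ({z} ×ˢ Set.univ) := fun μ => by
      rw [Measure.fst_apply (measurableSet_singleton z)]
      congr 1
      ext ⟨z', y⟩
      simp
    rw [← hfst] at h0 ⊢
    exact hac h0
  have h1 := (key α).1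
  have h2 := (key α').1
  have h0 := (key α).2
  have : (mass A z g k α B : ENNReal) * mass A z g k α' Set.univ =
      mass A z g k α' B * mass A z g k α Set.univ := by
    refine (ENNReal.mul_left_inj h0 (measure_ne_top _ _)).1 ?_
    calc _ = ((mass A z g k α B : ENNReal) * q ({z} ×ˢ Set.univ)) *
          mass A z g k α' Set.univ := by ring
      _ = (mass A z g k α' Set.univ * q ({z} ×ˢ B)) * mass A z g k α Set.univ := by
          rw [h1]; ring
      _ = _ := by rw [← h2]; ring
  exact_mod_cast this

/-- Kernels that vanish somewhere are limits of positive kernels. -/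
theorem GraphConditionallyBenign.mass_mul_mass
    (h : GraphConditionallyBenign G Z (interventionsOn X A \ {nullIntervention X}))
    (hZA : Disjoint Z A) (hA : A.Nonempty) {k : ∀ _ : Fin M, (∀ j, X j) → ℝ≥0}
    {g : (∀ j, X j) → unitInterval}
    (hk : ∀ i, DependsOn (k i) (insert i (G.parents (some i) : Set (Fin M))))
    (hsum : ∀ i x, ∑ t, k i (Function.update x i t) = 1)
    (hg : DependsOn g (G.parents none : Set (Fin M)))
    (z : ∀ i : Z, X i) (α α' : ∀ i, X i) {B : Set unitInterval} (hB : MeasurableSet B) :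
    mass A z g k α B * mass A z g k α' Set.univ = mass A z g k α' B * mass A z g k α Set.univ := by
  -- Mixing with the uniform kernel makes all kernels positive; both sides are continuous in `ε`, so
  -- `ε` may tend to `0`.
  let kε : ℝ≥0 → ∀ _ : Fin M, (∀ j, X j) → ℝ≥0 := fun ε i x =>
    (1 - ε) * k i x + ε * (Fintype.card (X i) : ℝ≥0)⁻¹
  have hcont : ∀ (α : ∀ i, X i) (B : Set unitInterval),
      Continuous fun ε => mass A z g (kε ε) α B := by
    intro α B
    unfold mass setKernel
    refine continuous_finsetSum _ fun x _ => Continuous.mul ?_ continuous_const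
    refine continuous_finsetProd _ fun i _ => ?_
    split_ifs <;> fun_prop
  have hpos : Set.EqOn (fun ε => mass A z g (kε ε) α B * mass A z g (kε ε) α' Set.univ)
      (fun ε => mass A z g (kε ε) α' B * mass A z g (kε ε) α Set.univ) (Set.Ioo 0 1) := by
    rintro ε ⟨h0, h1⟩
    refine h.mass_mul_mass_of_pos hZA hA (fun i x y hxy => ?_) (fun i x => ?_) (fun i x => ?_)
      hg z α α' hB
    · simp only [kε, hk i hxy]
    · simp only [kε]
      rw [Finset.sum_add_distrib, ← Finset.mul_sum, hsum]
      simp only [Finset.sum_const, Finset.card_univ, nsmul_eq_mul]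
      rw [mul_left_comm, mul_inv_cancel₀ (by simp), mul_one, mul_one, tsub_add_cancel_of_le h1.le]
    · have : 0 < ε * (Fintype.card (X i) : ℝ≥0)⁻¹ :=
        mul_pos h0 (inv_pos.2 (by exact_mod_cast Fintype.card_pos))
      exact (add_pos_of_nonneg_of_pos zero_le this).ne'
  have hcl := hpos.closure ((hcont α B).mul (hcont α' Set.univ))
    ((hcont α' B).mul (hcont α Set.univ))
  have hmem : (0 : ℝ≥0) ∈ closure (Set.Ioo (0 : ℝ≥0) 1) := by
    rw [closure_Ioo zero_ne_one]
    exact ⟨le_rfl, zero_le_one⟩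
  simpa [kε] using hcl hmem

/-- In the all-true context, reward `1` is impossible when `a` is set to false and possible when it
is set to true, while the context itself has positive mass under both actions. -/
theorem not_graphConditionallyBenign_of_isConnection [∀ i, Nontrivial (X i)]
    (hZA : Disjoint Z A) {a : Fin M} (ha : a ∈ A) {P F : Set (Option (Fin M))}
    {Pr : Option (Fin M) → Option (Fin M) → Prop}
    (hC : IsConnection (G.mutilate A).Arrow (some '' (Z : Set (Fin M)))
      (some '' (A : Set (Fin M))) none (some a) P F Pr) :
    ¬ GraphConditionallyBenign G Z (interventionsOn X A \ {nullIntervention X}) := by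
  classical
  intro hben
  have he : ∀ i, ∃ e : Bool → X i, Function.Injective e := fun i => by
    obtain ⟨s, t, hst⟩ := exists_pair_ne (X i)
    refine ⟨fun b => if b then s else t, fun b b' h => ?_⟩
    cases b <;> cases b' <;> simp_all
  choose e he using he
  let bit : (∀ j, X j) → Fin M → Bool := fun x i => decide (x i = e i true)
  have hbit : ∀ x i t, x i = e i t → bit x i = t := by
    intro x i t h
    simp only [bit, h, (he i).eq_iff]
    cases t <;> rfl
  have hpa : ∀ v u, (G.mutilate A).Arrow (some u) v → u ∈ G.parents v := fun v u h => by
    simp [CausalBanditGraph.parents, h.1]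
  have hnA : ∀ u i, (G.mutilate A).Arrow u (some i) → i ∉ A := fun u i h hi => h.2 i hi rfl
  have hprS : ∀ v u, Pr v u → ∃ j, u = some j := by
    intro v u h
    cases u with
    | none => exact absurd (hC.of_pr _ _ h).2.2 ((G.mutilate A).leaf v)
    | some j => exact ⟨j, rfl⟩
  obtain ⟨u₀', hu₀⟩ := hC.exists_pr
  obtain ⟨u₀, rfl⟩ := hprS _ _ hu₀
  -- A node of `F` also requires its parents in `F` to be true, so that failed agreement propagates
  -- down to `Z`.
  let flag : Fin M → (∀ j, X j) → Prop := fun i x =>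
    (∀ u ∈ G.parents (some i), ∀ v ∈ G.parents (some i), some u ∈ P → some v ∈ P →
      bit x u = bit x v) ∧ ∀ u ∈ G.parents (some i), some u ∈ F → bit x u = true
  -- The prescribed value of a node; `none` leaves the node uniformly random.
  let tgt : ∀ i, (∀ j, X j) → Option (X i) := fun i x =>
    if h : ∃ u, Pr (some i) (some u) then some (e i (bit x h.choose))
    else if some i ∈ F ∧ i ∉ A then some (e i (decide (flag i x))) else none
  have htgt_pr : ∀ i u x, Pr (some i) (some u) → tgt i x = some (e i (bit x u)) := by
    intro i u x h
    have hex : ∃ u, Pr (some i) (some u) := ⟨u, h⟩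
    simp only [tgt]
    rw [dif_pos hex, Option.some_inj.1 (hC.pr_unique _ _ _ hex.choose_spec h)]
  have htgt_F : ∀ i x, some i ∈ F → i ∉ A → tgt i x = some (e i (decide (flag i x))) := by
    intro i x h hi
    have hex : ¬ ∃ u, Pr (some i) (some u) := fun ⟨u, hu⟩ =>
      Set.disjoint_left.1 hC.disjoint (hC.of_pr _ _ hu).2.1 h
    simp only [tgt]
    rw [dif_neg hex, if_pos ⟨h, hi⟩]
  have htgt : ∀ i, DependsOn (tgt i) (G.parents (some i) : Set (Fin M)) := by
    intro i x y hxy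
    have hb : ∀ u ∈ G.parents (some i), bit x u = bit y u := fun u hu => by
      simp only [bit, hxy u hu]
    by_cases h : ∃ u, Pr (some i) (some u)
    · obtain ⟨u, hu⟩ := h
      rw [htgt_pr i u x hu, htgt_pr i u y hu, hb u (hpa _ _ (hC.of_pr _ _ hu).2.2)]
    · have hf : flag i x ↔ flag i y := by
        simp only [flag]
        refine and_congr (forall₂_congr fun u hu => forall₂_congr fun v hv => ?_)
          (forall₂_congr fun u hu => ?_)
        · rw [hb u hu, hb v hv]
        · rw [hb u hu]
      simp only [tgt]
      rw [dif_neg h, dif_neg h]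
      simp only [hf]
  let k : ∀ i : Fin M, (∀ j, X j) → ℝ≥0 := fun i x =>
    (tgt i x).elim (Fintype.card (X i) : ℝ≥0)⁻¹ fun s => if x i = s then 1 else 0
  have hk : ∀ i, DependsOn (k i) (insert i (G.parents (some i) : Set (Fin M))) := by
    intro i x y hxy
    simp only [k]
    rw [htgt i fun j hj => hxy j (.inr hj), hxy i (.inl rfl)]
  have hsum : ∀ i x, ∑ t, k i (Function.update x i t) = 1 := by
    intro i x
    have hi : i ∉ (G.parents (some i) : Set (Fin M)) := fun h => by
      simpa using parents_subset_Iio i h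
    have : ∀ t, tgt i (Function.update x i t) = tgt i x := fun t => (htgt i).update_eq hi x t
    simp only [k, this, Function.update_self]
    cases tgt i x <;> simp
  let g : (∀ j, X j) → unitInterval := fun x => if bit x u₀ then 1 else 0
  have hg : DependsOn g (G.parents none : Set (Fin M)) := by
    intro x y hxy
    simp only [g, bit, hxy u₀ (hpa _ _ (hC.of_pr _ _ hu₀).2.2)]
  -- A witness of positive mass: `P` carries the constant bit `t`, everything else is true. It also
  -- supplies the values for the intervention.
  let xs : Bool → ∀ i, X i := fun t i => if some i ∈ P then e i t else e i true
  have hxsP : ∀ t i, some i ∈ P → bit (xs t) i = t := fun t i hi =>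
    hbit _ _ _ (by simp [xs, hi])
  have hxsP' : ∀ t i, some i ∉ P → bit (xs t) i = true := fun t i hi =>
    hbit _ _ _ (by simp [xs, hi])
  let z : ∀ i : Z, X i := fun i => e i true
  have hxsz : ∀ t, Z.restrict (xs t) = z := by
    intro t
    ext i
    have : some i.1 ∉ P := fun h =>
      Set.disjoint_left.1 hC.disjoint_Z h ⟨i.1, i.2, rfl⟩
    simp [xs, this, z]
  have hxsk : ∀ t i, setKernel A (xs t) k i (xs t) ≠ 0 := by
    intro t i
    unfold setKernel
    by_cases hiA : i ∈ A
    · simp [hiA]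
    simp only [hiA, if_false, k]
    by_cases h : ∃ u, Pr (some i) (some u)
    · obtain ⟨u, hu⟩ := h
      obtain ⟨huP, hiP, -⟩ := hC.of_pr _ _ hu
      rw [htgt_pr i u _ hu, hxsP t u huP]
      simp [xs, hiP]
    · by_cases hF : some i ∈ F
      · have hnP : ∀ j, some j ∈ F → some j ∉ P := fun j hj hP =>
          Set.disjoint_left.1 hC.disjoint hP hj
        have hfl : flag i (xs t) := by
          refine ⟨fun u _ v _ hu hv => ?_, fun u _ hu => hxsP' t u (hnP u hu)⟩
          rw [hxsP t u hu, hxsP t v hv]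
        rw [htgt_F i _ hF hiA]
        simp [hfl, xs, hnP i hF]
      · simp only [tgt]
        rw [dif_neg h, if_neg fun h => hF h.1]
        simp
  have hmass_pos : ∀ t (B : Set unitInterval), g (xs t) ∈ B → mass A z g k (xs t) B ≠ 0 := by
    intro t B hB
    unfold mass
    refine ((Finset.sum_pos_iff).2 ⟨xs t, Finset.mem_univ _, pos_iff_ne_zero.2 ?_⟩).ne'
    refine mul_ne_zero (Finset.prod_ne_zero_iff.2 fun i _ => hxsk t i) ?_
    simp [contextIndicator, hxsz t, hB]
  have hmass_zero : mass A z g k (xs false) {1} = 0 := by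
    unfold mass
    refine Finset.sum_eq_zero fun x _ => ?_
    by_contra hne
    obtain ⟨h1, h2⟩ := mul_ne_zero_iff.1 hne
    obtain ⟨h2, h3⟩ := mul_ne_zero_iff.1 h2
    have hz : Z.restrict x = z := by
      by_contra hz
      simp [contextIndicator, hz] at h2
    have hg1 : bit x u₀ = true := by
      by_contra hb
      have hb' : bit x u₀ = false := by simpa using hb
      simp [g, hb'] at h3
    have hk1 : ∀ i, setKernel A (xs false) k i x ≠ 0 := fun i =>
      Finset.prod_ne_zero_iff.1 h1 i (Finset.mem_univ i)
    have hbt : ∀ i s, i ∉ A → tgt i x = some (e i s) → bit x i = s := by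
      intro i s hi hs
      have := hk1 i
      simp only [setKernel, hi, if_false, k, hs, Option.elim] at this
      exact hbit _ _ _ (by by_contra h; simp [h] at this)
    have hFS : ∀ c ∈ F, ∃ i, c = some i := by
      intro c hc
      cases c with
      | none =>
        rcases hC.exists_child _ hc with h | ⟨c, -, h⟩
        · simp at h
        · exact absurd h ((G.mutilate A).leaf c)
      | some i => exact ⟨i, rfl⟩
    -- Truth travels from `Z` back up through `F`: a true child in `F` has all its parents in `F`
    -- true. Children have larger indices, hence the induction on `M - i`.
    have hFb : ∀ n (i : Fin M), M - i ≤ n → some i ∈ F → bit x i = true := by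
      intro n
      induction n with
      | zero => intro i hi; have := i.2; omega
      | succ n ih =>
        intro i hi hF
        rcases hC.exists_child _ hF with ⟨j, hj, hji⟩ | ⟨c, hc, hr⟩
        · rw [Option.some_inj] at hji
          subst hji
          exact hbit _ _ _ (congrFun hz ⟨j, hj⟩)
        · obtain ⟨j, rfl⟩ := hFS c hc
          have hlt := (G.mutilate A).lt_of_arrow _ _ hr
          have hjb := ih j (by have := Fin.lt_def.1 hlt; have := j.2; omega) hc
          rw [hbt j _ (hnA _ _ hr) (htgt_F j x hc (hnA _ _ hr))] at hjb
          exact (of_decide_eq_true hjb).2 i (hpa _ _ hr) hF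
    -- The reward node is given the bit of its source `u₀`, so the signal at `Y` is the reward.
    have hsig := hC.eq_signal (fun v => v.elim (bit x u₀) (bit x)) ?_ ?_
    · have hxa : x a = xs false a := by
        have := hk1 a
        by_contra h
        simp [setKernel, ha, h] at this
      have hba : bit x a = false := hbit _ _ _ (by simp [hxa, xs, hC.mem])
      simp [hg1, hba] at hsig
    · intro v u h
      cases v with
      | none =>
        obtain rfl := hC.pr_unique _ _ _ h hu₀
        rfl
      | some i =>
        obtain ⟨u, rfl⟩ := hprS _ _ h
        exact hbt i _ (hnA _ _ (hC.of_pr _ _ h).2.2) (htgt_pr i u x h)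
    · intro c hc u hu v hv huc hvc
      obtain ⟨j, rfl⟩ := hFS c hc
      cases u with
      | none => exact absurd huc ((G.mutilate A).leaf _)
      | some u =>
        cases v with
        | none => exact absurd hvc ((G.mutilate A).leaf _)
        | some v =>
          have hjb := hFb _ j le_rfl hc
          rw [hbt j _ (hnA _ _ huc) (htgt_F j x hc (hnA _ _ huc))] at hjb
          exact (of_decide_eq_true hjb).1 u (hpa _ _ huc) v (hpa _ _ hvc) hu hv
  have hid := hben.mass_mul_mass hZA ⟨a, ha⟩ hk hsum hg z (xs false) (xs true)
    (measurableSet_singleton (1 : unitInterval))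
  rw [hmass_zero, zero_mul] at hid
  refine mul_ne_zero (hmass_pos true _ ?_) (hmass_pos false _ (Set.mem_univ _)) hid.symm
  simp [g, hxsP true u₀ (hC.of_pr _ _ hu₀).1]

end NotBenign

end CausalBandit

theorem mainTheorem7 {M : ℕ} (X : Fin M → Type*) [∀ i, Fintype (X i)] [∀ i, Nontrivial (X i)]
    [∀ i, MeasurableSpace (X i)] [∀ i, DiscreteMeasurableSpace (X i)]
    (G : CausalBandit.CausalBanditGraph M) (Z A : Finset (Fin M)) (hZA : Disjoint Z A)
    (hparents : ∀ i ∈ A, Disjoint (G.parents (some i)) Z) :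
    (G.mutilate A).DSeparates Z A ↔
      CausalBandit.GraphConditionallyBenign G Z
        (CausalBandit.interventionsOn X A \ {CausalBandit.nullIntervention X}) := by
  refine ⟨CausalBandit.graphConditionallyBenign_of_dSeparates G hZA, fun h => ?_⟩
  rw [(G.mutilate A).dSeparates_iff_not_reach hZA]
  intro d hd
  obtain ⟨_, ⟨a, ha, rfl⟩, P, F, Pr, hC⟩ := hd.exists_isConnection (G.mutilate A).arrow_asymm
    (by
      rw [Set.disjoint_image_iff (Option.some_injective _)]
      exact_mod_cast hZA)
    (by simp) (by simp) (G.mutilate A).leaf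
  exact CausalBandit.not_graphConditionallyBenign_of_isConnection hZA ha hC h
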